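/- Let $\mathbb{T}^n=\mathbb{R}^n/\mathbb{Z}^n$ with covering projection $\pi:\mathbb{R}^n\to\mathbb{T}^n$ and the flat Euclidean metric, and let $f:\mathbb{T}^n\to\mathbb{T}^n$ be a $C^1$ map that is volume expanding, i.e. there is $\sigma>1$ with $|\det D_xf|>\sigma$ for all $x$, and such that for every $x\in\mathbb{T}^n$ the pre-orbit $\{w\in f^{-k}(x):k\in\mathbb{N}\}$ is dense in $\mathbb{T}^n$. Let $U_0\subset\mathbb{T}^n$ be open and let $\widetilde U_0=\pi^{-1}(U_0)\cap(c+[0,1)^n)$ be its lift to some fundamental domain $c+[0,1)^n$, $c\in\mathbb{R}^n$. Measure distances and diameters in $\mathbb{R}^n$ with $\max_i|x_i-y_i|$, and suppose that $\operatorname{diam}(\widetilde U_0)<1$. Put $$\operatorname{diam}_{int}(U_0^c)=\min_{k\in\mathbb{Z}^n\setminus\{0\}}\operatorname{dist}(\widetilde U_0,\widetilde U_0+k)$$ (and $\operatorname{diam}_{int}(U_0^c)=1$ if $U_0=\emptyset$). Let $\Lambda_f\subset U_0^c$ be a locally maximal expanding set for $f$: it is compact, $f(\Lambda_f)=\Lambda_f$,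 there is $\lambda>1$ with $\|(D_xf)^{-1}\|^{-1}>\lambda$ for all $x\in\Lambda_f$, and there is an open $V\supset\Lambda_f$ with $\Lambda_f=\bigcap_{k\ge 0}f^{-k}(\overline V)$. Suppose that $\Lambda_f$ meets every sufficiently large arc in $U_0^c$, in the following sense: there is $0<\delta_0<\operatorname{diam}_{int}(U_0^c)$ such that every arc (injective continuous image of $[0,1]$) contained in $U_0^c$ whose lift to $\mathbb{R}^n$ has diameter larger than $\delta_0$ intersects $\Lambda_f$. Then the density of all pre-orbits is $C^1$-robust: there is a neighbourhood $\mathcal{U}$ of $f$ in the $C^1$ topology such that for every $g\in\mathcal{U}$ and every $x\in\mathbb{T}^n$ the set $\{w\in g^{-k}(x):k\in\mathbb{N}\}$ is dense in $\mathbb{T}^n$. -/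

import Mathlib

/-- The covering space `ℝⁿ` of the torus, with its Euclidean norm. -/
abbrev Cover (n : ℕ) : Type := EuclideanSpace ℝ (Fin n)

/-- The covering projection `π : ℝⁿ → 𝕋ⁿ = ℝⁿ/ℤⁿ`. -/
def torusProj {n : ℕ} (x : Cover n) : UnitAddTorus (Fin n) :=
  fun i => ((x i : ℝ) : UnitAddCircle)

/-- `F : ℝⁿ → ℝⁿ` is a lift of `f : 𝕋ⁿ → 𝕋ⁿ`. -/
def IsTorusLift {n : ℕ} (F : Cover n → Cover n)
    (f : UnitAddTorus (Fin n) → UnitAddTorus (Fin n)) : Prop :=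
  ∀ x, torusProj (F x) = f (torusProj x)

/-- The `C¹` endomorphisms of the torus: the maps that have a `C¹` lift to `ℝⁿ`
(every continuous map has a lift, unique up to an integer translation, and it is `C¹`
exactly when the map is, because `π` is a local diffeomorphism). -/
structure TorusEndo (n : ℕ) where
  toFun : UnitAddTorus (Fin n) → UnitAddTorus (Fin n)
  exists_lift : ∃ F : Cover n → Cover n, ContDiff ℝ 1 F ∧ IsTorusLift F toFun

/-- A `C¹` lift of `f`. -/
noncomputable def TorusEndo.lift {n : ℕ} (f : TorusEndo n) : Cover n → Cover n :=
  Classical.choose f.exists_lift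

/-- The derivative of `f` at the point `π x`, in the standard trivialization of the tangent
bundle of `𝕋ⁿ`. It depends neither on the lift nor on the choice of `x` over a given point,
since both only change by integer translations. -/
noncomputable def TorusEndo.derivAt {n : ℕ} (f : TorusEndo n) (x : Cover n) :
    Cover n →L[ℝ] Cover n :=
  fderiv ℝ f.lift x

/-- `g` is within `ε` of `f` in the `C¹` sense; these sets, `ε > 0`, form a neighbourhood basis
of `f` in the `C¹` topology. -/
def TorusEndo.C1Close {n : ℕ} (ε : ℝ) (f g : TorusEndo n) : Prop :=
  (∀ p, dist (f.toFun p) (g.toFun p) < ε) ∧ ∀ x, ‖f.derivAt x - g.derivAt x‖ < ε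

/-- A property holds `C¹`-robustly at `f` if it holds on a `C¹` neighbourhood of `f`. -/
def C1Robustly {n : ℕ} (P : TorusEndo n → Prop) (f : TorusEndo n) : Prop :=
  ∃ ε : ℝ, 0 < ε ∧ ∀ g : TorusEndo n, TorusEndo.C1Close ε f g → P g

/-- Volume expanding: `|det Df| > σ` everywhere, for some `σ > 1`. -/
def TorusEndo.VolumeExpanding {n : ℕ} (f : TorusEndo n) : Prop :=
  ∃ σ : ℝ, 1 < σ ∧ ∀ x, σ < |(f.derivAt x).det|

/-- The pre-orbit `{w ∈ f⁻ᵏ(p) : k ∈ ℕ}` of `p`. -/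
def TorusEndo.preOrbit {n : ℕ} (f : TorusEndo n) (p : UnitAddTorus (Fin n)) :
    Set (UnitAddTorus (Fin n)) :=
  {w | ∃ k : ℕ, f.toFun^[k] w = p}

/-- The pre-orbit of every point is dense. -/
def TorusEndo.DensePreOrbits {n : ℕ} (f : TorusEndo n) : Prop :=
  ∀ p, Dense (f.preOrbit p)

/-- The minimum norm `m{L} = ‖L⁻¹‖⁻¹`; for `n ≥ 1` it is `0` if `L` is not invertible. -/
noncomputable def minNorm {n : ℕ} (L : Cover n →L[ℝ] Cover n) : ℝ :=
  ‖ContinuousLinearMap.inverse L‖⁻¹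

/-- `f` is expanding in the set `S`. -/
def TorusEndo.ExpandingOn {n : ℕ} (f : TorusEndo n) (S : Set (UnitAddTorus (Fin n))) : Prop :=
  ∃ lam : ℝ, 1 < lam ∧ ∀ x : Cover n, torusProj x ∈ S → lam < minNorm (f.derivAt x)

/-- An expanding set: compact, invariant (`f(Λ) = Λ`), and `f` is expanding on it. -/
structure TorusEndo.IsExpandingSet {n : ℕ} (f : TorusEndo n)
    (Λ : Set (UnitAddTorus (Fin n))) : Prop where
  isCompact : IsCompact Λ
  invariant : f.toFun '' Λ = Λ
  expanding : f.ExpandingOn Λ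

/-- A locally maximal expanding set: it has an isolating block `V`. -/
structure TorusEndo.IsLocallyMaximalExpandingSet {n : ℕ} (f : TorusEndo n)
    (Λ : Set (UnitAddTorus (Fin n))) : Prop extends f.IsExpandingSet Λ where
  locallyMaximal : ∃ V : Set (UnitAddTorus (Fin n)), IsOpen V ∧ Λ ⊆ V ∧
    Λ = ⋂ k : ℕ, f.toFun^[k] ⁻¹' closure V

/-- The lift of `U ⊆ 𝕋ⁿ` restricted to the fundamental domain `c + [0,1)ⁿ`. -/
def frameLift {n : ℕ} (c : Cover n) (U : Set (UnitAddTorus (Fin n))) : Set (Cover n) :=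
  {x | torusProj x ∈ U ∧ ∀ i, c i ≤ x i ∧ x i < c i + 1}

/-- The diameter of a subset of `ℝⁿ` for the distance `max |xᵢ - yᵢ|`. -/
noncomputable def maxDiam {n : ℕ} (S : Set (Cover n)) : ℝ :=
  Metric.diam ((fun x : Cover n => (fun i => x i : Fin n → ℝ)) '' S)

/-- The internal diameter of `Uᶜ`: with `Ũ` the lift of `U` in the fundamental domain
`c + [0,1)ⁿ`, the minimum over `k ∈ ℤⁿ \ {0}` of the distance of `Ũ` and `Ũ + k`,
in the distance `max |xᵢ - yᵢ|`. For nonempty `U` and `n ≥ 1` this is at most `1`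
(take `k` a unit vector), so the additional element `1` only fixes the value `1` for `U = ∅`. -/
noncomputable def internalDiam {n : ℕ} (c : Cover n) (U : Set (UnitAddTorus (Fin n))) : ℝ :=
  sInf (insert 1 {r : ℝ | ∃ k : Fin n → ℤ, k ≠ 0 ∧ ∃ x ∈ frameLift c U, ∃ y ∈ frameLift c U,
    r = ‖(fun i => x i - (y i + (k i : ℝ)) : Fin n → ℝ)‖})

/-- Every arc in `S` of diameter larger than `δ` meets `Λ`. An arc in `𝕋ⁿ` is an injective
continuous image of `[0,1]`; it is written as `π ∘ γ` with `γ` a lift to `ℝⁿ`, and its diameter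
is that of the lift. -/
def LargeArcsMeet {n : ℕ} (S Λ : Set (UnitAddTorus (Fin n))) (δ : ℝ) : Prop :=
  ∀ γ : unitInterval → Cover n, Continuous γ →
    Function.Injective (fun t => torusProj (γ t)) →
    (∀ t, torusProj (γ t) ∈ S) → δ < maxDiam (Set.range γ) →
    ∃ t, torusProj (γ t) ∈ Λ

/-! Fix `g` near `f`, with a lift `G` near the lift `F` of `f`, and let `A` be open in `ℝⁿ`. It
suffices that some `G^[m] '' A` contains a ball of a radius `ρ` that depends only on `f`. Indeed,
density of the pre-orbits of `f` and compactness give, for all `g` near `f`, a preimage of every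
point in every such ball (`exists_forall_iterate_image_covers`).

To find the ball: a lower bound on the derivative makes `G` a homeomorphism of `ℝⁿ`, so the volume
of `G^[m] '' A` tends to infinity, and for a ball in `A` the image contains a path with endpoints
far apart. The lifts of `U₀` are bounded islands with mutual distance at least the internal
diameter; hence a long path has a subpath of diameter more than `δ₀` that stays away from all of
them (`exists_subpath_away_preimage`).

The arc hypothesis concerns the set `Λ` of `f`, not `g`. Instead of continuing `Λ` to `g`, a map `h`
near the identity is built for each finite time `N`, such that `h x ∈ Λ` forces `N` iterates of `x`
under `G` to stay near `Λ` (`exists_shadowing_map`). The image of the subpath under `h` is still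
long and outside `U₀`, so, after passing to embedded arcs, it meets `Λ`. Thus some point of the path
stays near `Λ` for `N` steps, and expansion there enlarges a small ball around it to radius `ρ`
(`exists_closedBall_subset_iterate_image`). -/

/-- `G` expands distances by the factor `κ` on the ball of radius `s` around `x`, and maps
the smaller balls around `x` over the corresponding expanded balls. -/
structure ExpandsAt {X Y : Type*} [PseudoMetricSpace X] [PseudoMetricSpace Y]
    (G : X → Y) (κ s : ℝ) (x : X) : Prop where
  antilipschitz : ∀ y ∈ Metric.closedBall x s, ∀ y' ∈ Metric.closedBall x s,
    κ * dist y y' ≤ dist (G y) (G y')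
  covers : ∀ r, 0 ≤ r → r ≤ s →
    Metric.closedBall (G x) (κ * r) ⊆ G '' Metric.closedBall x r

/-! ### Local expansion from bounds on the derivative. -/

theorem ContinuousLinearMap.isInvertible_of_le_norm {E : Type*} [NormedAddCommGroup E]
    [NormedSpace ℝ E] [FiniteDimensional ℝ E] (L : E →L[ℝ] E) {μ : ℝ} (hμ : 0 < μ)
    (hL : ∀ v, μ * ‖v‖ ≤ ‖L v‖) : ∃ e : E ≃L[ℝ] E, (e : E →L[ℝ] E) = L := by
  have hinj : Function.Injective (L : E →ₗ[ℝ] E) := by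
    rw [← LinearMap.ker_eq_bot, LinearMap.ker_eq_bot']
    intro v hv
    have := hL v
    have h0 : L v = 0 := hv
    rw [h0, norm_zero] at this
    by_contra hne
    have : 0 < ‖v‖ := norm_pos_iff.2 hne
    nlinarith
  refine ⟨(LinearEquiv.ofInjectiveEndo (L : E →ₗ[ℝ] E) hinj).toContinuousLinearEquiv, ?_⟩
  ext v
  simp

/-- A differentiable map whose derivative on a ball is close to a linear map with lower bound `μ`
expands there. -/
theorem expandsAt_of_fderiv {E : Type*} [NormedAddCommGroup E] [NormedSpace ℝ E]
    [FiniteDimensional ℝ E] {G : E → E} (hG : Differentiable ℝ G) {x : E} {s μ c : ℝ}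
    (L : E →L[ℝ] E) (hc : 0 ≤ c) (hcμ : c < μ) (hL : ∀ v, μ * ‖v‖ ≤ ‖L v‖)
    (hclose : ∀ y ∈ Metric.closedBall x s, ‖fderiv ℝ G y - L‖ ≤ c) :
    ExpandsAt G (μ - c) s x := by
  have hμ : 0 < μ := hc.trans_lt hcμ
  have happ : ∀ y ∈ Metric.closedBall x s, ∀ y' ∈ Metric.closedBall x s,
      ‖G y - G y' - L (y - y')‖ ≤ c * ‖y - y'‖ := by
    intro y hy y' hy'
    exact (convex_closedBall x s).norm_image_sub_le_of_norm_fderiv_le'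
      (fun z _ => hG z) hclose hy' hy
  obtain ⟨e, he⟩ := L.isInvertible_of_le_norm hμ hL
  refine ⟨fun y hy y' hy' => ?_, fun r hr hrs => ?_⟩
  · have h1 := happ y hy y' hy'
    have h2 := hL (y - y')
    have h3 := norm_sub_norm_le (L (y - y')) (G y - G y')
    rw [norm_sub_rev (L (y - y'))] at h3
    rw [dist_eq_norm, dist_eq_norm]
    linarith
  -- Quantitative inverse function theorem: with a right inverse of norm `μ⁻¹` and error `c`, balls
  -- are covered with factor `μ - c`.
  · let N : L.NonlinearRightInverse :=
      { toFun := e.symm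
        nnnorm := NNReal.mk μ⁻¹ (by positivity)
        bound' := fun y => by
          have := hL (e.symm y)
          rw [← he] at this
          simp only [ContinuousLinearEquiv.coe_coe, ContinuousLinearEquiv.apply_symm_apply] at this
          rw [NNReal.coe_mk, inv_mul_eq_div, le_div_iff₀ hμ]
          linarith
        right_inv' := fun y => by rw [← he]; simp }
    have hA : ApproximatesLinearOn G L (Metric.closedBall x r) (NNReal.mk c hc) := fun y hy y' hy' =>
      happ y (Metric.closedBall_subset_closedBall hrs hy) y'
        (Metric.closedBall_subset_closedBall hrs hy')
    have := hA.surjOn_closedBall_of_nonlinearRightInverse N hr subset_rfl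
    have hN : (N.nnnorm : ℝ)⁻¹ = μ := by simp [N]
    rw [hN] at this
    exact this

theorem ExpandsAt.mono_factor {X Y : Type*} [PseudoMetricSpace X] [PseudoMetricSpace Y]
    {G : X → Y} {κ κ' s : ℝ} {x : X} (h : ExpandsAt G κ s x) (hκ : κ' ≤ κ) :
    ExpandsAt G κ' s x :=
  ⟨fun y hy y' hy' => (mul_le_mul_of_nonneg_right hκ dist_nonneg).trans
      (h.antilipschitz y hy y' hy'),
    fun r hr hrs => (Metric.closedBall_subset_closedBall
      (mul_le_mul_of_nonneg_right hκ hr)).trans (h.covers r hr hrs)⟩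

theorem isOpenMap_of_expandsAt {X Y : Type*} [PseudoMetricSpace X] [PseudoMetricSpace Y]
    {G : X → Y} {κ s : ℝ} (hκ : 0 < κ) (hs : 0 < s) (h : ∀ x, ExpandsAt G κ s x) :
    IsOpenMap G := by
  intro U hU
  rw [Metric.isOpen_iff] at hU ⊢
  rintro _ ⟨x, hx, rfl⟩
  obtain ⟨r, hr, hrU⟩ := hU x hx
  have hmin : 0 < min (r / 2) s := by positivity
  refine ⟨κ * min (r / 2) s, by positivity, fun y hy => ?_⟩
  obtain ⟨z, hz, rfl⟩ := (h x).covers _ hmin.le (min_le_right _ _) (Metric.ball_subset_closedBall hy)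
  refine ⟨z, hrU ?_, rfl⟩
  rw [Metric.mem_closedBall] at hz
  rw [Metric.mem_ball]
  linarith [min_le_left (r / 2) s]

/-! ### Uniform local expansion implies global bijectivity. -/

section GlobalInverse

variable {E : Type*} [NormedAddCommGroup E] [NormedSpace ℝ E] {G : E → E} {κ s : ℝ}

/-- Sections of a uniformly expanding map exist on balls of any radius. -/
theorem exists_section_of_expandsAt (hκ : 0 < κ) (hs : 0 < s)
    (h : ∀ x, ExpandsAt G κ s x) (x₀ : E) (j : ℕ) :
    ∃ S : E → E, ContinuousOn S (Metric.ball (G x₀) (j * (κ * (s / 2)))) ∧ S (G x₀) = x₀ ∧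
      ∀ y ∈ Metric.ball (G x₀) (j * (κ * (s / 2))), G (S y) = y := by
  induction j with
  | zero => exact ⟨fun _ => x₀, continuousOn_const, rfl, fun y hy => by simp at hy⟩
  | succ j ih =>
    obtain ⟨S, hcont, hS0, hS⟩ := ih
    set y₀ := G x₀ with hy₀
    set β := κ * (s / 2) with hβ
    have hβ0 : 0 < β := by positivity
    -- Radial shrinking by `θ` maps the larger ball into the smaller one and moves points by at most
    -- `β`, so one application of `covers` extends the section.
    set θ : ℝ := j / (j + 1) with hθ
    have hj1 : (0 : ℝ) < j + 1 := by positivity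
    let q : E → E := fun y => y₀ + θ • (y - y₀)
    have hqc : Continuous q := by fun_prop
    have hq : ∀ y ∈ Metric.ball y₀ ((j + 1 : ℕ) * β), dist y (q y) ≤ β := by
      intro y hy
      have e : y - q y = (1 / ((j : ℝ) + 1)) • (y - y₀) := by
        have : (1 / ((j : ℝ) + 1)) = 1 - θ := by rw [hθ]; field_simp; ring
        rw [this, sub_smul, one_smul]; simp only [q]; abel
      rw [Metric.mem_ball, dist_eq_norm] at hy
      rw [dist_eq_norm, e, norm_smul, Real.norm_of_nonneg (by positivity)]
      push_cast at hy
      rw [div_mul_eq_mul_div, one_mul, div_le_iff₀ hj1]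
      linarith
    -- For `j = 0` the smaller ball is empty, and only the value of `S` at the center is available.
    have hqmem : ∀ y ∈ Metric.ball y₀ ((j + 1 : ℕ) * β),
        q y = y₀ ∨ q y ∈ Metric.ball y₀ (j * β) := by
      intro y hy
      rcases Nat.eq_zero_or_pos j with h0 | hpos
      · left; simp [q, hθ, h0]
      · right
        have hjp : (0 : ℝ) < j := by exact_mod_cast hpos
        rw [Metric.mem_ball, dist_eq_norm] at hy ⊢
        have : q y - y₀ = θ • (y - y₀) := by simp [q]
        rw [this, norm_smul, Real.norm_of_nonneg (by positivity)]
        push_cast at hy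
        calc θ * ‖y - y₀‖ < θ * ((j + 1) * β) := by gcongr
          _ = j * β := by rw [hθ]; field_simp
    have hGS : ∀ y ∈ Metric.ball y₀ ((j + 1 : ℕ) * β), G (S (q y)) = q y := by
      intro y hy
      rcases hqmem y hy with e | e
      · rw [e, hS0]
      · exact hS _ e
    have hSq : ContinuousOn (fun y => S (q y)) (Metric.ball y₀ ((j + 1 : ℕ) * β)) := by
      rcases Nat.eq_zero_or_pos j with h0 | hpos
      · refine (continuousOn_const (c := x₀)).congr fun y hy => ?_
        have : q y = y₀ := by simp [q, hθ, h0]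
        simp only [this, hS0]
      · refine hcont.comp hqc.continuousOn fun y hy => ?_
        rcases hqmem y hy with e | e
        · rw [e]; exact Metric.mem_ball_self (by positivity)
        · exact e
    have hex : ∀ y, ∃ x, y ∈ Metric.ball y₀ ((j + 1 : ℕ) * β) →
        x ∈ Metric.closedBall (S (q y)) (s / 2) ∧ G x = y := by
      intro y
      by_cases hy : y ∈ Metric.ball y₀ ((j + 1 : ℕ) * β)
      · have := (h (S (q y))).covers (s / 2) (by positivity) (by linarith)
        obtain ⟨x, hx, hxy⟩ := this (show y ∈ _ by
          rw [hGS y hy, Metric.mem_closedBall]; exact hq y hy)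
        exact ⟨x, fun _ => ⟨hx, hxy⟩⟩
      · exact ⟨x₀, fun h => absurd h hy⟩
    choose T hT using hex
    have hy₀mem : y₀ ∈ Metric.ball y₀ ((j + 1 : ℕ) * β) :=
      Metric.mem_ball_self (by positivity)
    refine ⟨T, ?_, ?_, fun y hy => (hT y hy).2⟩
    · intro y hy
      rw [Metric.continuousWithinAt_iff]
      intro ε hε
      obtain ⟨δ, hδ, hδS⟩ := Metric.continuousWithinAt_iff.1 (hSq y hy) (s / 2) (by positivity)
      refine ⟨min δ (κ * ε), by positivity, fun y' hy' hd => ?_⟩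
      have h1 := hδS hy' (hd.trans_le (min_le_left _ _))
      have h2 := (hT y hy).1
      have h3 := (hT y' hy').1
      rw [Metric.mem_closedBall] at h2 h3
      -- Both `T y` and `T y'` lie within `s` of `S (q y)`, since the radius `s / 2` was used twice;
      -- there `G` has a Lipschitz inverse.
      have h4 := (h (S (q y))).antilipschitz (T y')
        (by rw [Metric.mem_closedBall]; linarith [dist_triangle (T y') (S (q y')) (S (q y))])
        (T y) (by rw [Metric.mem_closedBall]; linarith)
      rw [(hT y hy).2, (hT y' hy').2] at h4
      have h5 := hd.trans_le (min_le_right _ _)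
      exact lt_of_mul_lt_mul_left (h4.trans_lt h5) hκ.le
    · have hq0 : q y₀ = y₀ := by simp [q]
      have h1 := hT y₀ hy₀mem
      rw [hq0, hS0] at h1
      have h4 := (h x₀).antilipschitz (T y₀)
        (Metric.closedBall_subset_closedBall (by linarith) h1.1) x₀
        (Metric.mem_closedBall_self hs.le)
      rw [h1.2, hy₀, dist_self] at h4
      have : dist (T y₀) x₀ ≤ 0 := by
        by_contra hcon
        push Not at hcon
        have := mul_pos hκ hcon
        linarith
      exact dist_le_zero.1 this

theorem exists_nat_mul_gt (hκ : 0 < κ) (hs : 0 < s) (R : ℝ) :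
    ∃ j : ℕ, R < j * (κ * (s / 2)) := by
  obtain ⟨j, hj⟩ := exists_nat_gt (R / (κ * (s / 2)))
  exact ⟨j, by rwa [div_lt_iff₀ (by positivity)] at hj⟩

theorem surjective_of_expandsAt (hκ : 0 < κ) (hs : 0 < s)
    (h : ∀ x, ExpandsAt G κ s x) : Function.Surjective G := by
  intro y
  obtain ⟨j, hj⟩ := exists_nat_mul_gt hκ hs (dist y (G 0))
  obtain ⟨S, -, -, hS⟩ := exists_section_of_expandsAt hκ hs h 0 j
  exact ⟨S y, hS y hj⟩

/-- A section `S` through `x₀`, defined on a ball containing the image of the segment to `x₁`,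
satisfies `S (G z) = z` along the segment by connectedness; so `x₁ = S (G x₁) = S (G x₀) = x₀`. -/
theorem injective_of_expandsAt (hκ : 0 < κ) (hs : 0 < s) (hG : Continuous G)
    (h : ∀ x, ExpandsAt G κ s x) : Function.Injective G := by
  intro x₀ x₁ hx
  have hKc : IsCompact (segment ℝ x₀ x₁) := by
    rw [segment_eq_image_lineMap]
    exact isCompact_Icc.image AffineMap.lineMap_continuous
  obtain ⟨R, hR⟩ := (hKc.image hG).isBounded.subset_ball (G x₀)
  obtain ⟨j, hj⟩ := exists_nat_mul_gt hκ hs R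
  obtain ⟨S, hSc, hS0, hS⟩ := exists_section_of_expandsAt hκ hs h x₀ j
  have hmaps : Set.MapsTo G (segment ℝ x₀ x₁) (Metric.ball (G x₀) (j * (κ * (s / 2)))) :=
    fun z hz => Metric.ball_subset_ball hj.le (hR ⟨z, hz, rfl⟩)
  have hSG : ContinuousOn (fun z => S (G z)) (segment ℝ x₀ x₁) :=
    hSc.comp hG.continuousOn hmaps
  have hpc : IsPreconnected (segment ℝ x₀ x₁) := (convex_segment x₀ x₁).isPreconnected
  have hd : ContinuousOn (fun z => dist (S (G z)) z) (segment ℝ x₀ x₁) :=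
    continuous_dist.comp_continuousOn (hSG.prodMk continuousOn_id)
  -- the distance of `S (G z)` and `z` is either `0` or larger than `s`
  have hgap : ∀ z ∈ segment ℝ x₀ x₁, dist (S (G z)) z ≤ s → dist (S (G z)) z = 0 := by
    intro z hz hzs
    have h4 := (h z).antilipschitz (S (G z)) hzs z (Metric.mem_closedBall_self hs.le)
    rw [hS _ (hmaps hz), dist_self] at h4
    by_contra hne
    have := mul_pos hκ (lt_of_le_of_ne dist_nonneg (Ne.symm hne))
    linarith
  have h0 : dist (S (G x₀)) x₀ = 0 := by rw [hS0, dist_self]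
  have h1 : dist (S (G x₁)) x₁ = 0 := by
    by_contra hne
    have hlt : s < dist (S (G x₁)) x₁ := by
      by_contra hle
      exact hne (hgap x₁ (right_mem_segment ℝ _ _) (not_lt.1 hle))
    obtain ⟨z, hz, hzs⟩ := hpc.intermediate_value (left_mem_segment ℝ _ _)
      (right_mem_segment ℝ _ _) hd (show s ∈ Set.Icc _ _ from ⟨by rw [h0]; exact hs.le, hlt.le⟩)
    have := hgap z hz hzs.le
    simp only at hzs
    linarith
  have h2 := dist_eq_zero.1 h1
  rw [← hx, hS0] at h2
  exact h2

end GlobalInverse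

/-! ### Volume growth under iteration. -/

theorem IsOpenMap.iterate_nat {X : Type*} [TopologicalSpace X] {f : X → X} (hf : IsOpenMap f)
    (m : ℕ) : IsOpenMap f^[m] := by
  induction m with
  | zero => exact IsOpenMap.id
  | succ m ih => rw [Function.iterate_succ]; exact ih.comp hf

-- Change of variables; injectivity ensures that the image is not covered several times.
open MeasureTheory in
theorem volume_iterate_image_ge {n : ℕ} {G : Cover n → Cover n} (hG : Differentiable ℝ G)
    (hinj : Function.Injective G) (hopen : IsOpenMap G) {σ : ℝ}
    (hdet : ∀ x, σ ≤ |(fderiv ℝ G x).det|) {A : Set (Cover n)} (hA : IsOpen A) (m : ℕ) :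
    ENNReal.ofReal σ ^ m * volume A ≤ volume (G^[m] '' A) := by
  induction m with
  | zero => simp
  | succ m ih =>
    have hAm : IsOpen (G^[m] '' A) := hopen.iterate_nat m A hA
    rw [Function.iterate_succ', Set.image_comp, pow_succ', mul_assoc]
    have h := lintegral_abs_det_fderiv_eq_addHaar_image volume hAm.measurableSet
      (fun x _ => (hG x).hasFDerivAt.hasFDerivWithinAt) hinj.injOn
    rw [← h]
    calc ENNReal.ofReal σ * (ENNReal.ofReal σ ^ m * volume A)
        ≤ ENNReal.ofReal σ * volume (G^[m] '' A) := by gcongr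
      _ = ∫⁻ _ in G^[m] '' A, ENNReal.ofReal σ := by simp
      _ ≤ _ := lintegral_mono fun x => ENNReal.ofReal_le_ofReal (hdet x)

open MeasureTheory in
/-- Under an injective volume expanding map the diameter of a ball becomes arbitrarily large. -/
theorem exists_iterate_image_not_subset_closedBall {n : ℕ} {G : Cover n → Cover n}
    (hG : Differentiable ℝ G)
    (hinj : Function.Injective G) (hopen : IsOpenMap G) {σ : ℝ} (hσ : 1 < σ)
    (hdet : ∀ x, σ ≤ |(fderiv ℝ G x).det|) {A : Set (Cover n)} (hA : IsOpen A)
    (hne : A.Nonempty) (R : ℝ) :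
    ∃ m : ℕ, ∀ p, ¬ G^[m] '' A ⊆ Metric.closedBall p R := by
  have hvol : volume A ≠ 0 := (hA.measure_pos volume hne).ne'
  have htop : Filter.Tendsto (fun m : ℕ => ENNReal.ofReal σ ^ m * volume A) Filter.atTop
      (nhds ⊤) := by
    have h1 : Filter.Tendsto (fun m : ℕ => ENNReal.ofReal σ ^ m) Filter.atTop (nhds ⊤) :=
      ENNReal.tendsto_pow_atTop_nhds_top_iff.2 (by simpa using hσ)
    have := ENNReal.Tendsto.mul_const (b := volume A) h1 (Or.inl ENNReal.top_ne_zero)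
    rwa [ENNReal.top_mul hvol] at this
  have hfin : volume (Metric.closedBall (0 : Cover n) R) < ⊤ := measure_closedBall_lt_top
  obtain ⟨m, hm⟩ := (htop.eventually (lt_mem_nhds hfin)).exists
  refine ⟨m, fun p hp => ?_⟩
  have h1 := (volume_iterate_image_ge hG hinj hopen hdet hA m).trans (measure_mono hp)
  rw [Measure.addHaar_closedBall_center] at h1
  exact absurd h1 (not_le.2 hm)

/-! ### The covering projection -/

/-- The integer vector `m` as a point of the covering space. -/
def intVec {n : ℕ} (m : Fin n → ℤ) : Cover n := WithLp.toLp 2 fun i => (m i : ℝ)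

@[simp] theorem intVec_apply {n : ℕ} (m : Fin n → ℤ) (i : Fin n) : intVec m i = m i := rfl

theorem continuous_torusProj {n : ℕ} : Continuous (torusProj (n := n)) := by
  unfold torusProj
  refine continuous_pi fun i => ?_
  exact (AddCircle.continuous_mk' 1).comp (by fun_prop)

theorem torusProj_eq_iff {n : ℕ} {x y : Cover n} :
    torusProj x = torusProj y ↔ ∃ m : Fin n → ℤ, x = y + intVec m := by
  constructor
  · intro h
    have h1 : ∀ i, ∃ k : ℤ, x i - y i = k := by
      intro i
      have := congrFun h i
      simp only [torusProj] at this
      rw [← sub_eq_zero, ← AddCircle.coe_sub, AddCircle.coe_eq_zero_iff] at this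
      obtain ⟨k, hk⟩ := this
      exact ⟨k, by simpa using hk.symm⟩
    choose m hm using h1
    refine ⟨m, ?_⟩
    ext i
    simp [← hm i]
  · rintro ⟨m, rfl⟩
    funext i
    simp only [torusProj, PiLp.add_apply, intVec_apply]
    rw [AddCircle.coe_add]
    have : ((m i : ℝ) : UnitAddCircle) = 0 := by
      rw [AddCircle.coe_eq_zero_iff]
      exact ⟨m i, by simp⟩
    rw [this, add_zero]

@[simp] theorem torusProj_add_intVec {n : ℕ} (x : Cover n) (m : Fin n → ℤ) :
    torusProj (x + intVec m) = torusProj x :=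
  torusProj_eq_iff.2 ⟨m, rfl⟩

@[simp] theorem torusProj_sub_intVec {n : ℕ} (x : Cover n) (m : Fin n → ℤ) :
    torusProj (x - intVec m) = torusProj x := by
  conv_rhs => rw [← sub_add_cancel x (intVec m)]
  rw [torusProj_add_intVec]

/-- The distance `max |xᵢ - yᵢ|` on the covering space. -/
noncomputable def maxDist {n : ℕ} (x y : Cover n) : ℝ := dist (WithLp.ofLp x) (WithLp.ofLp y)

theorem continuous_maxDist {n : ℕ} : Continuous fun p : Cover n × Cover n => maxDist p.1 p.2 := by
  unfold maxDist
  fun_prop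

theorem maxDist_le_dist {n : ℕ} (x y : Cover n) : maxDist x y ≤ dist x y := by
  unfold maxDist
  rw [dist_pi_le_iff dist_nonneg]
  intro i
  rw [Real.dist_eq, dist_eq_norm]
  exact PiLp.norm_apply_le (x - y) i

theorem one_le_maxDist {n : ℕ} {x y : Cover n} (h : torusProj x = torusProj y) (hne : x ≠ y) :
    1 ≤ maxDist x y := by
  obtain ⟨m, rfl⟩ := torusProj_eq_iff.1 h
  have hm : ∃ i, m i ≠ 0 := by
    by_contra hcon
    push Not at hcon
    apply hne
    ext i
    simp [hcon i]
  obtain ⟨i, hi⟩ := hm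
  have h1 := dist_le_pi_dist (WithLp.ofLp (y + intVec m)) (WithLp.ofLp y) i
  have h2 : dist ((y + intVec m).ofLp i) (y.ofLp i) = |(m i : ℝ)| := by
    simp
  rw [h2] at h1
  refine le_trans ?_ h1
  exact_mod_cast Int.one_le_abs hi

/-! ### Arcs -/

/-- The points `a` and `b` are joined in `O` by an arc, possibly degenerate. -/
def ArcJoined {X : Type*} [TopologicalSpace X] (O : Set X) (a b : X) : Prop :=
  ∃ T : ℝ, 0 ≤ T ∧ ∃ γ : ℝ → X, Continuous γ ∧ Set.InjOn γ (Set.Icc 0 T) ∧ γ 0 = a ∧ γ T = b ∧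
    Set.MapsTo γ (Set.Icc 0 T) O

section

variable {E : Type*} [NormedAddCommGroup E] [NormedSpace ℝ E]

/-- The arc is cut at its first entry into the ball and continued by a straight segment. The segment
stays in the ball by convexity and the arc was outside before, so injectivity survives. -/
theorem ArcJoined.of_mem_closedBall {O : Set E} {a q p : E} (h : ArcJoined O a q) {r : ℝ}
    (hr : Metric.closedBall q r ⊆ O) (hp : p ∈ Metric.closedBall q r) : ArcJoined O a p := by
  obtain ⟨T, hT, γ, hγ, hinj, h0, h1, hO⟩ := h
  have hcomp : IsCompact (Set.Icc 0 T ∩ γ ⁻¹' Metric.closedBall q r) :=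
    isCompact_Icc.inter_right (Metric.isClosed_closedBall.preimage hγ)
  have hr0 : 0 ≤ r := dist_nonneg.trans hp
  obtain ⟨τ, ⟨hτ, hτq⟩, hmin⟩ := hcomp.exists_isLeast
    ⟨T, ⟨hT, le_rfl⟩, by rw [Set.mem_preimage, h1]; exact Metric.mem_closedBall_self hr0⟩
  have hbefore : ∀ t ∈ Set.Icc 0 T, t < τ → γ t ∉ Metric.closedBall q r := fun t ht htτ hmem =>
    absurd (hmin ⟨ht, hmem⟩) (not_le.2 htτ)
  by_cases hpe : γ τ = p
  · exact ⟨τ, hτ.1, γ, hγ, hinj.mono (Set.Icc_subset_Icc_right hτ.2), h0, hpe,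
      hO.mono_left (Set.Icc_subset_Icc_right hτ.2)⟩
  let ℓ : ℝ → E := fun t => AffineMap.lineMap (γ τ) p (t - τ)
  have hℓ : Continuous ℓ := AffineMap.lineMap_continuous.comp (by fun_prop)
  have hℓinj : Function.Injective ℓ := by
    intro t t' htt
    have := AffineMap.lineMap_injective ℝ hpe htt
    linarith
  have hℓmem : ∀ t ∈ Set.Icc τ (τ + 1), ℓ t ∈ Metric.closedBall q r := by
    intro t ht
    refine (convex_closedBall q r).segment_subset hτq hp ?_
    rw [segment_eq_image_lineMap]
    exact ⟨t - τ, ⟨by linarith [ht.1], by linarith [ht.2]⟩, rfl⟩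
  have hℓτ : ℓ τ = γ τ := by simp [ℓ]
  refine ⟨τ + 1, by linarith [hτ.1], fun t => if t ≤ τ then γ t else ℓ t,
    Continuous.if_le hγ hℓ continuous_id continuous_const (fun t ht => by rw [ht, hℓτ]),
    ?_, ?_, ?_, ?_⟩
  · have key : ∀ t ∈ Set.Icc 0 (τ + 1), ∀ t' ∈ Set.Icc 0 (τ + 1), t ≤ τ → τ < t' →
        γ t ≠ ℓ t' := by
      intro t ht t' ht' htτ ht'τ heq
      rcases htτ.lt_or_eq with hlt | rfl
      · exact hbefore t ⟨ht.1, htτ.trans hτ.2⟩ hlt (heq ▸ hℓmem t' ⟨ht'τ.le, ht'.2⟩)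
      · rw [← hℓτ] at heq
        exact ht'τ.ne (hℓinj heq)
    intro t ht t' ht' heq
    simp only at heq
    split_ifs at heq with h1 h2 h2
    · exact hinj ⟨ht.1, h1.trans hτ.2⟩ ⟨ht'.1, h2.trans hτ.2⟩ heq
    · exact absurd heq (key t ht t' ht' h1 (not_le.1 h2))
    · exact absurd heq.symm (key t' ht' t ht h2 (not_le.1 h1))
    · exact hℓinj heq
  · simp [hτ.1, h0]
  · simp [ℓ]
  · intro t ht
    simp only
    split_ifs with h1
    · exact hO ⟨ht.1, h1.trans hτ.2⟩
    · exact hr (hℓmem t ⟨(not_le.1 h1).le, ht.2⟩)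

/-- The points of `O` reachable from `a` by arcs form a set that is open with open complement in
`O`. -/
theorem IsPreconnected.arcJoined {K O : Set E} (hK : IsPreconnected K) (hO : IsOpen O)
    (hKO : K ⊆ O) {a b : E} (ha : a ∈ K) (hb : b ∈ K) : ArcJoined O a b := by
  set R := {p | p ∈ O ∧ ArcJoined O a p} with hR
  have hball : ∀ p ∈ O, ∃ r, 0 < r ∧ Metric.closedBall p r ⊆ O := fun p hp =>
    Metric.nhds_basis_closedBall.mem_iff.1 (hO.mem_nhds hp)
  have hRo : IsOpen R := by
    rw [Metric.isOpen_iff]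
    rintro p ⟨hpO, hp⟩
    obtain ⟨r, hr, hrO⟩ := hball p hpO
    exact ⟨r, hr, fun q hq => ⟨hrO (Metric.ball_subset_closedBall hq),
      hp.of_mem_closedBall hrO (Metric.ball_subset_closedBall hq)⟩⟩
  have hRc : IsOpen (O \ R) := by
    rw [Metric.isOpen_iff]
    rintro p ⟨hpO, hp⟩
    obtain ⟨r, hr, hrO⟩ := hball p hpO
    refine ⟨r / 2, by positivity, fun q hq => ⟨hrO ?_, fun hqR => hp ⟨hpO, ?_⟩⟩⟩
    · rw [Metric.mem_ball] at hq; rw [Metric.mem_closedBall]; linarith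
    · refine hqR.2.of_mem_closedBall (r := r / 2) (fun z hz => hrO ?_) ?_
      · rw [Metric.mem_ball] at hq; rw [Metric.mem_closedBall] at hz ⊢
        linarith [dist_triangle z q p]
      · rw [Metric.mem_closedBall, dist_comm]; exact (Metric.mem_ball.1 hq).le
  have haR : a ∈ R := ⟨hKO ha, 0, le_rfl, fun _ => a, continuous_const,
    by simp, rfl, rfl, fun _ _ => hKO ha⟩
  have := hK.subset_left_of_subset_union hRo hRc Set.disjoint_sdiff_right
    (fun x hx => by
      by_cases h : x ∈ R
      · exact Or.inl h
      · exact Or.inr ⟨hKO hx, h⟩) ⟨a, ha, haR⟩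
  exact (this hb).2

end

/-- An arc in `ℝⁿ` of diameter more than `δ < 1` contains a subarc of diameter more than `δ` which
is embedded in the torus. -/
theorem exists_subarc_injOn_torusProj {n : ℕ} {γ : ℝ → Cover n} (hγ : Continuous γ) {T δ : ℝ}
    (hT : 0 ≤ T) (hinj : Set.InjOn γ (Set.Icc 0 T)) (hδ0 : 0 ≤ δ) (hδ : δ < 1)
    (hdist : δ < maxDist (γ 0) (γ T)) :
    ∃ s t, 0 ≤ s ∧ s < t ∧ t ≤ T ∧ Set.InjOn (fun u => torusProj (γ u)) (Set.Icc s t) ∧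
      δ < maxDist (γ s) (γ t) := by
  -- Parameter pairs where the projected arc closes up. The condition `1 ≤ maxDist` holds
  -- automatically off the diagonal; it excludes the diagonal while keeping `D` closed.
  set D : Set (ℝ × ℝ) := (Set.Icc 0 T ×ˢ Set.Icc 0 T) ∩
    {p | p.1 ≤ p.2 ∧ torusProj (γ p.1) = torusProj (γ p.2) ∧ 1 ≤ maxDist (γ p.1) (γ p.2)} with hD
  have hpair : ∀ u ∈ Set.Icc 0 T, ∀ v ∈ Set.Icc 0 T, u < v →
      torusProj (γ u) = torusProj (γ v) → (u, v) ∈ D := fun u hu v hv huv he =>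
    ⟨⟨hu, hv⟩, huv.le, he, one_le_maxDist he fun h => huv.ne (hinj hu hv h)⟩
  have hmd : Continuous fun p : ℝ × ℝ => maxDist (γ p.1) (γ p.2) :=
    continuous_maxDist.comp ((hγ.comp continuous_fst).prodMk (hγ.comp continuous_snd))
  have hDc : IsCompact D := by
    refine (isCompact_Icc.prod isCompact_Icc).inter_right ?_
    refine (isClosed_le continuous_fst continuous_snd).inter (IsClosed.inter ?_ ?_)
    · exact isClosed_eq (continuous_torusProj.comp (hγ.comp continuous_fst))
        (continuous_torusProj.comp (hγ.comp continuous_snd))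
    · exact isClosed_le continuous_const hmd
  rcases D.eq_empty_or_nonempty with hemp | hne
  · have hTpos : 0 < T := by
      rcases hT.lt_or_eq with h | h
      · exact h
      · subst h; simp [maxDist] at hdist; linarith
    refine ⟨0, T, le_rfl, hTpos, le_rfl, fun u hu v hv he => ?_, hdist⟩
    by_contra hne
    rcases lt_or_gt_of_ne hne with h | h
    · have := hpair u hu v hv h he; rw [hemp] at this; exact this
    · have := hpair v hv u hu h he.symm; rw [hemp] at this; exact this
  -- A shortest loop has no coincidence other than its endpoints, and these are at distance at least
  -- `1 > δ` in `ℝⁿ`. Stopping slightly before `t` leaves an embedded arc that is still long enough.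
  · obtain ⟨⟨s, t⟩, ⟨⟨hs, ht⟩, hst, hpr, hone⟩, hmin⟩ := hDc.exists_isMinOn hne
      (f := fun p : ℝ × ℝ => p.2 - p.1) (by fun_prop)
    simp only at hs ht hst hpr hone
    have hlt : s < t := by
      rcases hst.lt_or_eq with h | h
      · exact h
      · subst h; simp [maxDist] at hone; linarith
    have hev : ∀ᶠ u in nhdsWithin t (Set.Iio t), δ < maxDist (γ s) (γ u) := by
      have hc : Continuous fun u => maxDist (γ s) (γ u) :=
        hmd.comp (continuous_const.prodMk continuous_id)
      exact (hc.continuousAt.eventually (lt_mem_nhds (hδ.trans_le hone))).filter_mono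
        nhdsWithin_le_nhds
    have hev2 : ∀ᶠ u in nhdsWithin t (Set.Iio t), u ∈ Set.Ioo s t :=
      Ioo_mem_nhdsLT hlt
    obtain ⟨u, hu1, hu2⟩ := (hev.and hev2).exists
    have hsub : Set.Icc s u ⊆ Set.Icc 0 T :=
      Set.Icc_subset_Icc hs.1 (hu2.2.le.trans ht.2)
    have key : ∀ v ∈ Set.Icc s u, ∀ w ∈ Set.Icc s u, v < w →
        torusProj (γ v) ≠ torusProj (γ w) := by
      intro v hv w hw hvw he
      have := hmin (hpair v (hsub hv) w (hsub hw) hvw he)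
      simp only [Set.mem_ofPred_eq] at this
      linarith [hv.1, hw.2, hu2.2]
    refine ⟨s, u, hs.1, hu2.1, hu2.2.le.trans ht.2, fun v hv w hw he => ?_, hu1⟩
    by_contra hne
    rcases lt_or_gt_of_ne hne with h | h
    · exact key v hv w hw h he
    · exact key w hw v hv h he.symm

/-- Transfers the hypothesis on embedded arcs to arbitrary connected sets. Since the arc is only
found in a neighbourhood `O` of `K`, so is the point over `Λ`. -/
theorem LargeArcsMeet.exists_mem_of_isPreconnected {n : ℕ} {S Λ : Set (UnitAddTorus (Fin n))}
    {δ : ℝ} (h : LargeArcsMeet S Λ δ) (hδ0 : 0 ≤ δ) (hδ : δ < 1) {K O : Set (Cover n)}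
    (hK : IsPreconnected K) (hO : IsOpen O) (hOS : ∀ x ∈ O, torusProj x ∈ S) (hKO : K ⊆ O)
    {a b : Cover n} (ha : a ∈ K) (hb : b ∈ K) (hab : δ < maxDist a b) :
    ∃ x ∈ O, torusProj x ∈ Λ := by
  obtain ⟨T, hT, γ, hγ, hinj, rfl, rfl, hγO⟩ := hK.arcJoined hO hKO ha hb
  obtain ⟨s, t, hs, hst, htT, hinj', hd⟩ :=
    exists_subarc_injOn_torusProj hγ hT hinj hδ0 hδ hab
  let ℓ : unitInterval → ℝ := fun u => s + (t - s) * u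
  have hℓc : Continuous ℓ := by fun_prop
  have hℓ : ∀ u, ℓ u ∈ Set.Icc s t := by
    intro u
    have h0 := u.2.1
    have h1 := u.2.2
    constructor
    · simp only [ℓ]; nlinarith
    · simp only [ℓ]; nlinarith
  have hmem : ∀ u, γ (ℓ u) ∈ O := fun u =>
    hγO ⟨hs.trans (hℓ u).1, (hℓ u).2.trans htT⟩
  obtain ⟨u, hu⟩ := h (fun u => γ (ℓ u)) (hγ.comp hℓc) (by
      intro u v huv
      have := hinj' (hℓ u) (hℓ v) huv
      simp only [ℓ, add_right_inj] at this
      exact Subtype.ext (mul_left_cancel₀ (sub_ne_zero.2 hst.ne') this))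
    (fun u => hOS _ (hmem u)) (by
      have hbdd : Bornology.IsBounded ((fun x : Cover n => (fun i => x i : Fin n → ℝ)) ''
          Set.range fun u => γ (ℓ u)) := by
        refine ((isCompact_range (hγ.comp hℓc)).image ?_).isBounded
        fun_prop
      have h0 : γ (ℓ 0) = γ s := by simp [ℓ]
      have h1 : γ (ℓ 1) = γ t := by simp [ℓ]
      refine hd.trans_le ?_
      exact Metric.dist_le_diam_of_mem hbdd ⟨_, ⟨0, rfl⟩, by rw [← h0]⟩ ⟨_, ⟨1, rfl⟩, by rw [← h1]⟩)
  exact ⟨_, hmem u, hu⟩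

/-! ### Long paths between separated islands. -/

section Crossing

variable {X : Type*} [PseudoMetricSpace X]

theorem exists_last_mem {α : ℝ → X} (hα : Continuous α) {A : Set X} (hA : IsClosed A) {a b : ℝ}
    (hab : a ≤ b) (ha : α a ∈ A) :
    ∃ s ∈ Set.Icc a b, α s ∈ A ∧ ∀ u ∈ Set.Ioc s b, α u ∉ A := by
  obtain ⟨s, ⟨hs, hsA⟩, hmax⟩ := (isCompact_Icc.inter_right (hA.preimage hα)).exists_isGreatest
    (⟨a, ⟨le_rfl, hab⟩, ha⟩ : (Set.Icc a b ∩ α ⁻¹' A).Nonempty)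
  exact ⟨s, hs, hsA, fun u hu huA =>
    absurd (hmax ⟨⟨hs.1.trans hu.1.le, hu.2⟩, huA⟩) (not_le.2 hu.1)⟩

theorem exists_first_mem {α : ℝ → X} (hα : Continuous α) {A : Set X} (hA : IsClosed A) {a b : ℝ}
    (hab : a ≤ b) (hb : α b ∈ A) :
    ∃ s ∈ Set.Icc a b, α s ∈ A ∧ ∀ u ∈ Set.Ico a s, α u ∉ A := by
  obtain ⟨s, ⟨hs, hsA⟩, hmin⟩ := (isCompact_Icc.inter_right (hA.preimage hα)).exists_isLeast
    (⟨b, ⟨hab, le_rfl⟩, hb⟩ : (Set.Icc a b ∩ α ⁻¹' A).Nonempty)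
  exact ⟨s, hs, hsA, fun u hu huA =>
    absurd (hmin ⟨⟨hu.1, hu.2.le.trans hs.2⟩, huA⟩) (not_le.2 hu.2)⟩

/-- A path from the closed set `A` to the closed set `B` contains a subpath from `A` to `B` which
avoids both sets in between. -/
theorem exists_crossing {α : ℝ → X} (hα : Continuous α) {A B : Set X} (hA : IsClosed A)
    (hB : IsClosed B) {a b : ℝ} (hab : a ≤ b) (ha : α a ∈ A) (hb : α b ∈ B) :
    ∃ s t, a ≤ s ∧ s ≤ t ∧ t ≤ b ∧ α s ∈ A ∧ α t ∈ B ∧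
      ∀ u ∈ Set.Ioo s t, α u ∉ A ∧ α u ∉ B := by
  obtain ⟨t, ht, htB, htmin⟩ := exists_first_mem hα hB hab hb
  obtain ⟨s, hs, hsA, hsmax⟩ := exists_last_mem hα hA ht.1 ha
  exact ⟨s, t, hs.1, hs.2, ht.2, hsA, htB, fun u hu =>
    ⟨hsmax u ⟨hu.1, hu.2.le⟩, htmin u ⟨hs.1.trans hu.1.le, hu.2⟩⟩⟩

/-- A long path has a subpath of diameter more than `δ` which stays `η`-away from a family of
sets of diameter at most `1` with mutual distances larger than `δ + 2η`. -/
theorem exists_subpath_away {ι : Type*} (P : ι → Set X) {D δ η : ℝ} (hδ : 0 ≤ δ) (hη : 0 < η)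
    (hD : δ + 2 * η < D) (hD1 : D ≤ 1)
    (hsep : ∀ i j, i ≠ j → ∀ x ∈ P i, ∀ y ∈ P j, D ≤ dist x y)
    (hdiam : ∀ i, ∀ x ∈ P i, ∀ y ∈ P i, dist x y ≤ 1)
    {α : ℝ → X} (hα : Continuous α) (hlong : 4 < dist (α 0) (α 1)) :
    ∃ s t, 0 ≤ s ∧ s ≤ t ∧ t ≤ 1 ∧ δ < dist (α s) (α t) ∧
      ∀ u ∈ Set.Icc s t, ∀ i, ∀ p ∈ P i, η ≤ dist (α u) p := by
  -- Room for a constant above `η`: a point of a closed `η`-thickening need only have points of the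
  -- set at distance less than `η'`.
  obtain ⟨η', hηη', hη'D⟩ : ∃ η', η < η' ∧ δ + 2 * η' < D :=
    ⟨η + (D - δ - 2 * η) / 4, by linarith, by linarith⟩
  have hη'0 : 0 < η' := hη.trans hηη'
  suffices hsuff : ∃ s t, 0 ≤ s ∧ s ≤ t ∧ t ≤ 1 ∧ δ < dist (α s) (α t) ∧
      ∀ u ∈ Set.Ioo s t, ∀ i, α u ∉ Metric.cthickening η (P i) by
    obtain ⟨s, t, hs, hst, ht, hd, haway⟩ := hsuff
    refine ⟨s, t, hs, hst, ht, hd, fun u hu i p hp => ?_⟩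
    have hne : s ≠ t := by
      rintro rfl
      rw [dist_self] at hd
      linarith
    have hcl : IsClosed {u | η ≤ dist (α u) p} :=
      isClosed_le continuous_const (hα.dist continuous_const)
    have hsub : closure (Set.Ioo s t) ⊆ {u | η ≤ dist (α u) p} := by
      refine closure_minimal (fun v hv => ?_) hcl
      by_contra hlt
      exact haway v hv i (Metric.mem_cthickening_of_dist_le _ p _ _ hp (not_le.1 hlt).le)
    rw [closure_Ioo hne] at hsub
    exact hsub hu
  have hnear : ∀ (S : Set X) (x : X), x ∈ Metric.cthickening η S → ∃ p ∈ S, dist x p < η' := by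
    intro S x hx
    have := Metric.cthickening_subset_thickening' hη'0 hηη' S hx
    exact Metric.mem_thickening_iff.1 this
  by_cases hall : ∀ u ∈ Set.Icc (0 : ℝ) 1, ∀ i, α u ∉ Metric.cthickening η (P i)
  · exact ⟨0, 1, le_rfl, zero_le_one, le_rfl, by linarith, fun u hu => hall u ⟨hu.1.le, hu.2.le⟩⟩
  push Not at hall
  obtain ⟨u₀, hu₀, k, hk⟩ := hall
  set A := Metric.cthickening η (P k) with hA
  set B := Metric.cthickening η (⋃ (j) (_ : j ≠ k), P j) with hB
  have hAc : IsClosed A := Metric.isClosed_cthickening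
  have hBc : IsClosed B := Metric.isClosed_cthickening
  have hAB : ∀ x ∈ A, ∀ y ∈ B, δ < dist x y := by
    intro x hx y hy
    obtain ⟨p, hp, hxp⟩ := hnear _ _ hx
    obtain ⟨q, hq, hyq⟩ := hnear _ _ hy
    simp only [Set.mem_iUnion] at hq
    obtain ⟨j, hj, hq⟩ := hq
    have h1 := hsep k j hj.symm p hp q hq
    have h2 := dist_triangle4 p x y q
    rw [dist_comm p x] at h2
    linarith
  have hAA : ∀ x ∈ A, ∀ y ∈ A, dist x y ≤ 1 + 2 * η' := by
    intro x hx y hy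
    obtain ⟨p, hp, hxp⟩ := hnear _ _ hx
    obtain ⟨q, hq, hyq⟩ := hnear _ _ hy
    have h1 := hdiam k p hp q hq
    have h2 := dist_triangle4 x p q y
    rw [dist_comm q y] at h2
    linarith
  have hcover : ∀ x, x ∉ A → x ∉ B → ∀ i, x ∉ Metric.cthickening η (P i) := by
    intro x hxA hxB i hxi
    by_cases hik : i = k
    · subst hik; exact hxA hxi
    · exact hxB (Metric.cthickening_subset_of_subset _
        (Set.subset_iUnion₂ (s := fun j (_ : j ≠ k) => P j) i hik) hxi)
  by_cases hvisit : ∃ u₁ ∈ Set.Icc (0 : ℝ) 1, α u₁ ∈ B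
  · obtain ⟨u₁, hu₁, hu₁B⟩ := hvisit
    rcases le_total u₀ u₁ with hle | hle
    · obtain ⟨s, t, hs, hst, ht, hsA, htB, hbetween⟩ := exists_crossing hα hAc hBc hle hk hu₁B
      exact ⟨s, t, hu₀.1.trans hs, hst, ht.trans hu₁.2, hAB _ hsA _ htB,
        fun u hu => hcover _ (hbetween u hu).1 (hbetween u hu).2⟩
    · obtain ⟨s, t, hs, hst, ht, hsB, htA, hbetween⟩ := exists_crossing hα hBc hAc hle hu₁B hk
      exact ⟨s, t, hu₁.1.trans hs, hst, ht.trans hu₀.2, by rw [dist_comm]; exact hAB _ htA _ hsB,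
        fun u hu => hcover _ (hbetween u hu).2 (hbetween u hu).1⟩
  -- Only the island `k` is visited, so the path is free before its first and after its last visit.
  -- One endpoint is at distance at least `2` from `α u₀`, and `A` has diameter at most `1 + 2 *
  -- η'`; what remains is at least `1 - 2 * η' > δ`.
  · push Not at hvisit
    have htri := dist_triangle (α 0) (α u₀) (α 1)
    rcases le_or_gt (dist (α u₀) (α 1)) 2 with hle | hgt
    · obtain ⟨t, ht, htA, hbefore⟩ := exists_first_mem hα hAc hu₀.1 hk
      refine ⟨0, t, le_rfl, ht.1, ht.2.trans hu₀.2, ?_, fun u hu =>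
        hcover _ (hbefore u ⟨hu.1.le, hu.2⟩) (hvisit u ⟨hu.1.le, hu.2.le.trans (ht.2.trans hu₀.2)⟩)⟩
      have h1 := hAA _ htA _ hk
      have h2 := dist_triangle (α 0) (α t) (α u₀)
      linarith
    · obtain ⟨s, hs, hsA, hafter⟩ := exists_last_mem hα hAc hu₀.2 hk
      refine ⟨s, 1, hu₀.1.trans hs.1, hs.2, le_rfl, ?_, fun u hu =>
        hcover _ (hafter u ⟨hu.1, hu.2.le⟩) (hvisit u ⟨(hu₀.1.trans hs.1).trans hu.1.le, hu.2.le⟩)⟩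
      have h1 := hAA _ hk _ hsA
      have h2 := dist_triangle (α u₀) (α s) (α 1)
      linarith

end Crossing

/-! ### Lifts of a subset of the torus -/

theorem exists_sub_intVec_mem_frame {n : ℕ} (c x : Cover n) :
    ∃ m : Fin n → ℤ, ∀ i, c i ≤ (x - intVec m) i ∧ (x - intVec m) i < c i + 1 := by
  refine ⟨fun i => ⌊x i - c i⌋, fun i => ?_⟩
  have h1 := Int.floor_le (x i - c i)
  have h2 := Int.lt_floor_add_one (x i - c i)
  simp only [PiLp.sub_apply, intVec_apply]
  constructor <;> linarith

theorem internalDiam_le_one {n : ℕ} (c : Cover n) (U : Set (UnitAddTorus (Fin n))) :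
    internalDiam c U ≤ 1 := by
  refine csInf_le ⟨0, ?_⟩ (Set.mem_insert _ _)
  rintro r (rfl | ⟨k, -, x, -, y, -, rfl⟩)
  · exact zero_le_one
  · exact norm_nonneg _

theorem internalDiam_le_maxDist {n : ℕ} {c : Cover n} {U : Set (UnitAddTorus (Fin n))}
    {x y : Cover n} (hx : x ∈ frameLift c U) (hy : y ∈ frameLift c U) {j k : Fin n → ℤ}
    (hjk : j ≠ k) : internalDiam c U ≤ maxDist (x + intVec j) (y + intVec k) := by
  refine csInf_le ⟨0, ?_⟩ (Set.mem_insert_of_mem _ ⟨k - j, sub_ne_zero.2 hjk.symm, x, hx, y, hy, ?_⟩)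
  · rintro r (rfl | ⟨k, -, x, -, y, -, rfl⟩)
    · exact zero_le_one
    · exact norm_nonneg _
  · rw [maxDist, dist_eq_norm]
    congr 1
    funext i
    simp
    ring

theorem maxDist_le_one_of_mem_frameLift {n : ℕ} {c : Cover n} {U : Set (UnitAddTorus (Fin n))}
    {x y : Cover n} (hx : x ∈ frameLift c U) (hy : y ∈ frameLift c U) : maxDist x y ≤ 1 := by
  rw [maxDist, dist_pi_le_iff zero_le_one]
  intro i
  rw [Real.dist_eq, abs_le]
  have h1 := hx.2 i
  have h2 := hy.2 i
  constructor <;> linarith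

/-- A long path in `ℝⁿ` has a subpath of diameter more than `δ` which stays away from the preimage
of `U` in `ℝⁿ`, provided that `δ` is smaller than the internal diameter of the complement. -/
theorem exists_subpath_away_preimage {n : ℕ} {c : Cover n} {U : Set (UnitAddTorus (Fin n))}
    {δ η : ℝ} (hδ : 0 ≤ δ) (hη : 0 < η) (hD : δ + 2 * η < internalDiam c U)
    {α : ℝ → Cover n} (hα : Continuous α) (hlong : 4 < maxDist (α 0) (α 1)) :
    ∃ s t, 0 ≤ s ∧ s ≤ t ∧ t ≤ 1 ∧ δ < maxDist (α s) (α t) ∧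
      ∀ u ∈ Set.Icc s t, ∀ p, torusProj p ∈ U → η ≤ maxDist (α u) p := by
  let P : (Fin n → ℤ) → Set (Fin n → ℝ) := fun k =>
    (fun x : Cover n => WithLp.ofLp (x + intVec k)) '' frameLift c U
  obtain ⟨s, t, hs, hst, ht, hd, haway⟩ := exists_subpath_away P hδ hη hD (internalDiam_le_one c U)
    (by
      rintro j k hjk _ ⟨x, hx, rfl⟩ _ ⟨y, hy, rfl⟩
      exact internalDiam_le_maxDist hx hy hjk)
    (by
      rintro k _ ⟨x, hx, rfl⟩ _ ⟨y, hy, rfl⟩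
      simpa [maxDist] using maxDist_le_one_of_mem_frameLift hx hy)
    (α := fun u => WithLp.ofLp (α u)) (by fun_prop) hlong
  refine ⟨s, t, hs, hst, ht, hd, fun u hu p hp => ?_⟩
  obtain ⟨m, hm⟩ := exists_sub_intVec_mem_frame c p
  exact haway u hu m (WithLp.ofLp p) ⟨p - intVec m, ⟨by simpa using hp, hm⟩, by simp⟩

/-! ### Shadowing near an expanding invariant set -/

section Shadowing

variable {E : Type*} [NormedAddCommGroup E] [NormedSpace ℝ E]

/-- Let `F` be a homeomorphism expanding near the forward invariant set `Λ` and `G` uniformly close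
to `F`. For every `N` there is a map `h` close to the identity with `h x ∈ Λ` only if the first `N`
iterates of `x` under `G` stay near `Λ`. -/
theorem exists_shadowing_map {F G Finv : E → E} (hFl : ∀ x, Finv (F x) = x)
    (hFr : ∀ y, F (Finv y) = y) (hFinv : Continuous Finv) (hG : Continuous G) {Λ : Set E}
    (hΛ : ∀ x ∈ Λ, F x ∈ Λ) {lam ρ : ℝ} (hρ : 0 < ρ)
    (hexp : ∀ x ∈ Metric.cthickening (2 * ρ) Λ, ExpandsAt F lam ρ x)
    (hclose : ∀ x, dist (F x) (G x) ≤ (lam - 1) * ρ) (N : ℕ) :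
    ∃ h : E → E, Continuous h ∧ (∀ x, dist (h x) x ≤ ρ) ∧
      ∀ x, h x ∈ Λ → ∀ k ≤ N, G^[k] x ∈ Metric.cthickening ρ Λ := by
  have hnear : ∀ (h : E → E), (∀ x, dist (h x) x ≤ ρ) → ∀ x, h x ∈ Λ →
      x ∈ Metric.cthickening ρ Λ := fun h hh x hx =>
    Metric.mem_cthickening_of_dist_le x (h x) ρ Λ hx (by rw [dist_comm]; exact hh x)
  induction N with
  | zero =>
    refine ⟨id, continuous_id, fun x => by simpa using hρ.le, fun x hx k hk => ?_⟩
    obtain rfl : k = 0 := by omega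
    exact hnear id (fun x => by simpa using hρ.le) x hx
  | succ N ih =>
    obtain ⟨h, hc, hid, hsh⟩ := ih
    -- The next map is `Finv ∘ h ∘ G` near `Λ`, where expansion keeps it within `ρ` of the identity;
    -- the cutoff `φ` blends it into the identity elsewhere.
    obtain ⟨φ, hφ0, hφ1, hφ⟩ := exists_continuous_zero_one_of_isClosed
      (Metric.isOpen_thickening (δ := 2 * ρ) (E := Λ)).isClosed_compl
      (Metric.isClosed_cthickening (δ := ρ) (E := Λ))
      (Set.disjoint_compl_left_iff_subset.2
        (Metric.cthickening_subset_thickening' (by positivity) (by linarith) Λ))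
    have hbound : ∀ x, dist (x + φ x • (Finv (h (G x)) - x)) x ≤ ρ := by
      intro x
      rw [dist_eq_norm, add_sub_cancel_left, norm_smul, Real.norm_of_nonneg (hφ x).1]
      by_cases hx : x ∈ Metric.thickening (2 * ρ) Λ
      · have hd : dist (h (G x)) (F x) ≤ lam * ρ := by
          have h1 := dist_triangle (h (G x)) (G x) (F x)
          have h2 := hid (G x)
          have h3 := hclose x
          rw [dist_comm] at h3
          linarith
        obtain ⟨y, hy, hyF⟩ := (hexp x (Metric.thickening_subset_cthickening _ _ hx)).covers ρ hρ.le
          le_rfl hd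
        rw [← hyF, hFl, ← dist_eq_norm]
        have hy' : dist y x ≤ ρ := hy
        calc φ x * dist y x ≤ 1 * dist y x := by gcongr; exact (hφ x).2
          _ ≤ ρ := by rwa [one_mul]
      · rw [hφ0 hx]
        simpa using hρ.le
    refine ⟨fun x => x + φ x • (Finv (h (G x)) - x), ?_, hbound, fun x hx k hk => ?_⟩
    · exact continuous_id.add (φ.continuous.smul
        ((hFinv.comp (hc.comp hG)).sub continuous_id))
    · have hxΛ := hnear _ hbound x hx
      have hone : φ x = 1 := hφ1 hxΛ
      simp only [hone, one_smul, add_sub_cancel] at hx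
      rcases Nat.eq_zero_or_pos k with rfl | hpos
      · exact hxΛ
      · obtain ⟨j, rfl⟩ : ∃ j, k = j + 1 := ⟨k - 1, by omega⟩
        rw [Function.iterate_succ_apply]
        refine hsh (G x) ?_ j (by omega)
        have := hΛ _ hx
        rwa [hFr] at this

/-- A ball whose center stays in a region of expansion grows to a definite size. -/
theorem closedBall_subset_iterate_image {X : Type*} [PseudoMetricSpace X] {G : X → X}
    {lam r s : ℝ} (hlam : 1 ≤ lam) (hr : 0 ≤ r) (hs : 0 ≤ s) {x : X} {W : Set X}
    (hW : Metric.closedBall x s ⊆ W) (N : ℕ) (hexp : ∀ k < N, ExpandsAt G lam r (G^[k] x)) :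
    Metric.closedBall (G^[N] x) (min (lam ^ N * s) r) ⊆ G^[N] '' W := by
  induction N with
  | zero =>
    simp only [pow_zero, one_mul, Function.iterate_zero, id_eq, Set.image_id]
    exact (Metric.closedBall_subset_closedBall (min_le_left _ _)).trans hW
  | succ N ih =>
    have h1 := ih fun k hk => hexp k (by omega)
    rw [Function.iterate_succ_apply', Function.iterate_succ', Set.image_comp]
    refine Set.Subset.trans ?_ (Set.image_mono h1)
    have hmin : 0 ≤ min (lam ^ N * s) r := le_min (by positivity) hr
    refine Set.Subset.trans ?_ ((hexp N (by omega)).covers _ hmin (min_le_right _ _))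
    refine Metric.closedBall_subset_closedBall ?_
    rw [pow_succ']
    rcases min_cases (lam ^ N * s) r with ⟨h, -⟩ | ⟨h, -⟩
    · rw [h, mul_assoc]; exact min_le_left _ _
    · rw [h]; exact (min_le_right _ _).trans (by nlinarith)

/-- The covered radius depends only on `κ`, `s` and `k`, hence is uniform over all maps `G` near
`F`. -/
theorem closedBall_pow_subset_iterate_image {X : Type*} [PseudoMetricSpace X] {G : X → X}
    {κ s₀ s : ℝ} (hκ : 0 ≤ κ) (hκ1 : κ ≤ 1) (hs : 0 ≤ s) (hss : s ≤ s₀)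
    (hexp : ∀ x, ExpandsAt G κ s₀ x) (w : X) (k : ℕ) :
    Metric.closedBall (G^[k] w) (κ ^ k * s) ⊆ G^[k] '' Metric.closedBall w s := by
  induction k with
  | zero => simp
  | succ k ih =>
    rw [Function.iterate_succ_apply', Function.iterate_succ', Set.image_comp]
    refine Set.Subset.trans ?_ (Set.image_mono ih)
    have hle : κ ^ k * s ≤ s₀ :=
      (mul_le_of_le_one_left hs (pow_le_one₀ hκ hκ1)).trans hss
    rw [pow_succ', mul_assoc]
    exact (hexp _).covers _ (by positivity) hle

theorem exists_forall_dist_iterate_lt {X : Type*} [PseudoMetricSpace X] {F : X → X}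
    (hF : Continuous F) (w : X) (k : ℕ) {τ : ℝ} (hτ : 0 < τ) :
    ∃ ε > 0, ∀ G : X → X, (∀ x, dist (F x) (G x) < ε) → dist (F^[k] w) (G^[k] w) < τ := by
  induction k generalizing τ with
  | zero => exact ⟨1, one_pos, fun G _ => by simpa using hτ⟩
  | succ k ih =>
    obtain ⟨δ, hδ, hδF⟩ := Metric.continuousAt_iff.1 (hF.continuousAt (x := F^[k] w)) (τ / 2)
      (by positivity)
    obtain ⟨ε, hε, hεG⟩ := ih hδ
    refine ⟨min ε (τ / 2), by positivity, fun G hG => ?_⟩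
    have h1 := hεG G fun x => (hG x).trans_le (min_le_left _ _)
    rw [dist_comm] at h1
    have h2 := hδF h1
    have h3 := (hG (G^[k] w)).trans_le (min_le_right _ _)
    rw [Function.iterate_succ_apply', Function.iterate_succ_apply']
    have h4 := dist_triangle (F (F^[k] w)) (F (G^[k] w)) (G (G^[k] w))
    rw [dist_comm] at h2
    linarith

end Shadowing

/-! ### Robustness of coverings by balls of a given size -/

theorem isOpenMap_torusProj {n : ℕ} : IsOpenMap (torusProj (n := n)) := by
  have h1 : IsOpenMap (Pi.map fun (_ : Fin n) (x : ℝ) => (x : UnitAddCircle)) :=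
    IsOpenMap.piMap (fun _ => QuotientAddGroup.isOpenMap_coe)
      (Filter.Eventually.of_forall fun _ => QuotientAddGroup.mk_surjective)
  exact h1.comp (PiLp.homeomorph 2 (fun _ : Fin n => ℝ)).isOpenMap

theorem IsTorusLift.iterate {n : ℕ} {F : Cover n → Cover n}
    {f : UnitAddTorus (Fin n) → UnitAddTorus (Fin n)} (h : IsTorusLift F f) (k : ℕ) :
    IsTorusLift F^[k] f^[k] := by
  induction k with
  | zero => exact fun x => rfl
  | succ k ih =>
    intro x
    rw [Function.iterate_succ_apply, Function.iterate_succ_apply, ih, h]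

theorem isCompact_unitCube (n : ℕ) : IsCompact {x : Cover n | ∀ i, 0 ≤ x i ∧ x i ≤ 1} := by
  have h : IsCompact (Set.Icc (0 : Fin n → ℝ) 1) := isCompact_Icc
  have := (PiLp.homeomorph 2 (fun _ : Fin n => ℝ)).isCompact_preimage.2 h
  convert this using 1
  ext x
  simp only [Set.mem_ofPred_eq, forall_and]
  exact Iff.rfl

theorem exists_sub_intVec_mem_unitCube {n : ℕ} (x : Cover n) :
    ∃ m : Fin n → ℤ, x - intVec m ∈ {x : Cover n | ∀ i, 0 ≤ x i ∧ x i ≤ 1} := by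
  obtain ⟨m, hm⟩ := exists_sub_intVec_mem_frame 0 x
  exact ⟨m, fun i => ⟨by simpa using (hm i).1, by simpa using (hm i).2.le⟩⟩

/-- If the pre-orbits of `f` are dense, then for all maps `G` near a lift of `f` which are
uniformly open, the iterates of all balls of radius `r` cover the torus. -/
theorem exists_forall_iterate_image_covers {n : ℕ} {f : TorusEndo n} (hdense : f.DensePreOrbits)
    {F : Cover n → Cover n} (hF : Continuous F) (hlift : IsTorusLift F f.toFun) {r κ s₀ : ℝ}
    (hr : 0 < r) (hκ : 0 < κ) (hs₀ : 0 < s₀) :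
    ∃ ε > 0, ∀ G : Cover n → Cover n, (∀ x, dist (F x) (G x) < ε) →
      (∀ x, ExpandsAt G κ s₀ x) → ∀ g, IsTorusLift G g → ∀ z q : Cover n,
      ∃ k, ∃ w ∈ Metric.closedBall z r, g^[k] (torusProj w) = torusProj q := by
  wlog hκ1 : κ ≤ 1 generalizing κ
  · obtain ⟨ε, hε, h⟩ := this one_pos le_rfl
    exact ⟨ε, hε, fun G hG hexp => h G hG fun x => (hexp x).mono_factor (not_le.1 hκ1).le⟩
  -- Near a single pair: a preimage `w₀` of `q₀` under an iterate of `f` exists close to `z₀`. The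
  -- iterate of `G` at `w₀` lands nearby, and its image of a small ball around `w₀` covers a
  -- neighbourhood of the target.
  have hlocal : ∀ z₀ q₀ : Cover n, ∃ ε > 0, ∃ β > 0, ∀ G : Cover n → Cover n,
      (∀ x, dist (F x) (G x) < ε) → (∀ x, ExpandsAt G κ s₀ x) →
      ∀ z ∈ Metric.ball z₀ β, ∀ q ∈ Metric.ball q₀ β,
      ∃ k, ∃ w ∈ Metric.closedBall z r, torusProj (G^[k] w) = torusProj q := by
    intro z₀ q₀
    obtain ⟨_, ⟨w₀, hw₀, rfl⟩, k, hk⟩ := (hdense (torusProj q₀)).inter_open_nonempty _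
      (isOpenMap_torusProj _ (Metric.isOpen_ball (x := z₀) (ε := r / 3)))
      ⟨_, z₀, Metric.mem_ball_self (by positivity), rfl⟩
    rw [← hlift.iterate k, torusProj_eq_iff] at hk
    obtain ⟨m, hm⟩ := hk
    set s := min (r / 3) s₀ with hs
    have hs0 : 0 < s := by positivity
    have hτ : 0 < κ ^ k * s / 2 := by positivity
    obtain ⟨ε, hε, hεG⟩ := exists_forall_dist_iterate_lt hF w₀ k hτ
    refine ⟨ε, hε, min (κ ^ k * s / 2) (r / 3), by positivity, fun G hG hexp z hz q hq => ?_⟩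
    have h1 := hεG G hG
    have hmem : q + intVec m ∈ Metric.closedBall (G^[k] w₀) (κ ^ k * s) := by
      rw [Metric.mem_closedBall]
      have h2 := dist_triangle (q + intVec m) (F^[k] w₀) (G^[k] w₀)
      have h3 : dist (q + intVec m) (F^[k] w₀) < κ ^ k * s / 2 := by
        rw [hm, dist_add_right]
        exact (Metric.mem_ball.1 hq).trans_le (min_le_left _ _)
      linarith
    obtain ⟨w, hw, hwq⟩ := closedBall_pow_subset_iterate_image hκ.le hκ1 hs0.le (min_le_right _ _)
      hexp w₀ k hmem
    refine ⟨k, w, ?_, by rw [hwq, torusProj_add_intVec]⟩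
    have h4 := (Metric.mem_ball.1 hz).trans_le (min_le_right _ _)
    have h5 : dist w w₀ ≤ r / 3 := (Metric.mem_closedBall.1 hw).trans (min_le_left _ _)
    have h6 := Metric.mem_ball.1 hw₀
    have h7 := dist_triangle4 w w₀ z₀ z
    rw [dist_comm z₀ z] at h7
    rw [Metric.mem_closedBall]
    linarith
  have hcompact := (isCompact_unitCube n).prod (isCompact_unitCube n)
  have hunif : ∃ ε > 0, ∀ G : Cover n → Cover n, (∀ x, dist (F x) (G x) < ε) →
      (∀ x, ExpandsAt G κ s₀ x) →
      ∀ p ∈ {x : Cover n | ∀ i, 0 ≤ x i ∧ x i ≤ 1} ×ˢ {x : Cover n | ∀ i, 0 ≤ x i ∧ x i ≤ 1},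
      ∃ k, ∃ w ∈ Metric.closedBall p.1 r, torusProj (G^[k] w) = torusProj p.2 := by
    refine hcompact.induction_on (p := fun S => ∃ ε > 0, ∀ G : Cover n → Cover n,
      (∀ x, dist (F x) (G x) < ε) → (∀ x, ExpandsAt G κ s₀ x) →
      ∀ p ∈ S, ∃ k, ∃ w ∈ Metric.closedBall p.1 r, torusProj (G^[k] w) = torusProj p.2)
      ⟨1, one_pos, fun G _ _ p hp => absurd hp (Set.notMem_empty p)⟩ ?_ ?_ ?_
    · rintro S S' hSS ⟨ε, hε, h⟩
      exact ⟨ε, hε, fun G hG hexp p hp => h G hG hexp p (hSS hp)⟩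
    · rintro S S' ⟨ε, hε, h⟩ ⟨ε', hε', h'⟩
      refine ⟨min ε ε', lt_min hε hε', fun G hG hexp p hp => ?_⟩
      rcases hp with hp | hp
      · exact h G (fun x => (hG x).trans_le (min_le_left _ _)) hexp p hp
      · exact h' G (fun x => (hG x).trans_le (min_le_right _ _)) hexp p hp
    · rintro ⟨z₀, q₀⟩ -
      obtain ⟨ε, hε, β, hβ, h⟩ := hlocal z₀ q₀
      refine ⟨Metric.ball z₀ β ×ˢ Metric.ball q₀ β, mem_nhdsWithin_of_mem_nhds
        (prod_mem_nhds (Metric.ball_mem_nhds _ hβ) (Metric.ball_mem_nhds _ hβ)), ε, hε,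
        fun G hG hexp p hp => h G hG hexp _ hp.1 _ hp.2⟩
  obtain ⟨ε, hε, h⟩ := hunif
  refine ⟨ε, hε, fun G hG hexp g hg z q => ?_⟩
  obtain ⟨m, hm⟩ := exists_sub_intVec_mem_unitCube z
  obtain ⟨m', hm'⟩ := exists_sub_intVec_mem_unitCube q
  obtain ⟨k, w, hw, hwq⟩ := h G hG hexp (z - intVec m, q - intVec m') ⟨hm, hm'⟩
  refine ⟨k, w + intVec m, ?_, ?_⟩
  · rw [Metric.mem_closedBall, ← dist_sub_right _ _ (intVec m), add_sub_cancel_right]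
    exact hw
  · rw [torusProj_add_intVec, ← hg.iterate k, hwq, torusProj_sub_intVec]

/-! ### Lifts of torus maps -/

theorem round_eq_of_abs_sub_lt {t : ℝ} {k : ℤ} (h : |t - k| < 1 / 2) : round t = k := by
  rw [abs_lt] at h
  rw [round_eq, Int.floor_eq_iff]
  constructor <;> linarith

theorem exists_int_forall_abs_sub_lt {X : Type*} [TopologicalSpace X] [PreconnectedSpace X]
    [Nonempty X] {D : X → ℝ} (hD : Continuous D) {ε : ℝ} (hε : ε ≤ 1 / 4)
    (h : ∀ x, ‖(D x : UnitAddCircle)‖ < ε) : ∃ k : ℤ, ∀ x, |D x - k| < ε := by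
  obtain ⟨x₀⟩ := ‹Nonempty X›
  simp only [UnitAddCircle.norm_eq] at h
  refine ⟨round (D x₀), ?_⟩
  set k := round (D x₀) with hk
  have hsmall : ∀ x, |D x - k| < 1 / 2 → |D x - k| < ε := by
    intro x hx
    have := h x
    rwa [round_eq_of_abs_sub_lt hx] at this
  intro x
  apply hsmall
  by_contra hge
  have hc : Continuous fun x => |D x - k| := by fun_prop
  -- The value `3 / 8` lies in the forbidden gap between `ε ≤ 1 / 4` and `1 / 2`.
  obtain ⟨y, hy⟩ := mem_range_of_exists_le_of_exists_ge hc (c := 3 / 8)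
    ⟨x₀, by linarith [h x₀]⟩ ⟨x, by linarith⟩
  simp only at hy
  have := hsmall y (by linarith)
  linarith

/-- Two maps to `ℝⁿ` whose projections to the torus are uniformly close differ by an integer vector
up to a small error. -/
theorem exists_intVec_forall_maxDist_lt {n : ℕ} {X : Type*} [TopologicalSpace X]
    [PreconnectedSpace X] [Nonempty X] {A B : X → Cover n} (hA : Continuous A) (hB : Continuous B)
    {ε : ℝ} (hε0 : 0 < ε) (hε : ε ≤ 1 / 4) (h : ∀ x, dist (torusProj (A x)) (torusProj (B x)) < ε) :
    ∃ m : Fin n → ℤ, ∀ x, maxDist (A x) (B x + intVec m) < ε := by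
  have h1 : ∀ i, ∃ k : ℤ, ∀ x, |(A x i - B x i) - k| < ε := by
    intro i
    refine exists_int_forall_abs_sub_lt (by fun_prop) hε fun x => ?_
    have := (dist_le_pi_dist (torusProj (A x)) (torusProj (B x)) i).trans_lt (h x)
    rw [dist_eq_norm] at this
    simpa only [torusProj, ← AddCircle.coe_sub] using this
  choose m hm using h1
  refine ⟨m, fun x => ?_⟩
  rw [maxDist, dist_pi_lt_iff hε0]
  intro i
  rw [Real.dist_eq]
  have := hm i x
  simp only [PiLp.add_apply, intVec_apply]
  rwa [← sub_sub]

theorem exists_intVec_forall_eq {n : ℕ} {X : Type*} [TopologicalSpace X] [PreconnectedSpace X]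
    [Nonempty X] {A B : X → Cover n} (hA : Continuous A) (hB : Continuous B)
    (h : ∀ x, torusProj (A x) = torusProj (B x)) :
    ∃ m : Fin n → ℤ, ∀ x, A x = B x + intVec m := by
  obtain ⟨m, hm⟩ := exists_intVec_forall_maxDist_lt hA hB (ε := 1 / 4) (by norm_num) le_rfl
    (fun x => by rw [h x, dist_self]; norm_num)
  refine ⟨m, fun x => ?_⟩
  by_contra hne
  have := one_le_maxDist (by rw [torusProj_add_intVec, h x]) hne
  linarith [hm x]

theorem TorusEndo.contDiff_lift {n : ℕ} (f : TorusEndo n) : ContDiff ℝ 1 f.lift :=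
  (Classical.choose_spec f.exists_lift).1

theorem TorusEndo.isTorusLift_lift {n : ℕ} (f : TorusEndo n) : IsTorusLift f.lift f.toFun :=
  (Classical.choose_spec f.exists_lift).2

theorem TorusEndo.continuous_derivAt {n : ℕ} (f : TorusEndo n) : Continuous f.derivAt :=
  f.contDiff_lift.continuous_fderiv one_ne_zero

/-- This periodicity turns bounds on the compact unit cube into global ones. -/
theorem TorusEndo.derivAt_sub_intVec {n : ℕ} (f : TorusEndo n) (x : Cover n) (m : Fin n → ℤ) :
    f.derivAt (x - intVec m) = f.derivAt x := by
  have hc := f.contDiff_lift.continuous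
  obtain ⟨m', hm'⟩ := exists_intVec_forall_eq (A := fun y => f.lift (y - intVec m)) (B := f.lift)
    (by fun_prop) hc (fun y => by
      rw [f.isTorusLift_lift, f.isTorusLift_lift, torusProj_sub_intVec])
  have h1 := fderiv_comp_add_right (𝕜 := ℝ) (f := f.lift) (x := x) (-intVec m)
  unfold TorusEndo.derivAt
  simp only [← sub_eq_add_neg, hm', fderiv_add_const] at h1
  exact h1.symm

theorem exists_dist_le_mul_maxDist (n : ℕ) :
    ∃ C : ℝ, 0 < C ∧ ∀ x y : Cover n, dist x y ≤ C * maxDist x y := by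
  obtain ⟨K, h⟩ : ∃ K, AntilipschitzWith K (WithLp.ofLp : Cover n → Fin n → ℝ) :=
    ⟨_, PiLp.antilipschitzWith_ofLp 2 (fun _ : Fin n => ℝ)⟩
  refine ⟨K + 1, add_pos_of_nonneg_of_pos K.coe_nonneg one_pos, fun x y =>
    (h.le_mul_dist x y).trans ?_⟩
  rw [maxDist]
  gcongr
  exact le_add_of_nonneg_right zero_le_one

/-- A map near `f` has a lift near the lift of `f`. -/
theorem TorusEndo.C1Close.exists_lift {n : ℕ} {f g : TorusEndo n} {ε : ℝ}
    (h : TorusEndo.C1Close ε f g) (hε : ε ≤ 1 / 4) :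
    ∃ G : Cover n → Cover n, Differentiable ℝ G ∧ IsTorusLift G g.toFun ∧
      (∀ x, maxDist (f.lift x) (G x) < ε) ∧ ∀ x, ‖f.derivAt x - fderiv ℝ G x‖ < ε := by
  have hε0 : 0 < ε := dist_nonneg.trans_lt (h.1 0)
  obtain ⟨m, hm⟩ := exists_intVec_forall_maxDist_lt f.contDiff_lift.continuous
    g.contDiff_lift.continuous hε0 hε (fun x => by
      rw [f.isTorusLift_lift, g.isTorusLift_lift]; exact h.1 _)
  refine ⟨fun x => g.lift x + intVec m, ?_, fun x => ?_, hm, fun x => ?_⟩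
  · exact (g.contDiff_lift.differentiable one_ne_zero).add_const _
  · rw [torusProj_add_intVec, g.isTorusLift_lift]
  · rw [fderiv_add_const]; exact h.2 x

/-! ### Uniform bounds for the derivative -/

theorem TorusEndo.uniformContinuous_derivAt {n : ℕ} (f : TorusEndo n) {ω : ℝ} (hω : 0 < ω) :
    ∃ s > 0, ∀ x y, dist x y ≤ s → ‖f.derivAt y - f.derivAt x‖ ≤ ω := by
  -- Only one of the two points has to lie in the cube, so a single translation suffices below.
  have h := (isCompact_unitCube n).uniformContinuousAt_of_continuousAt f.derivAt
    (fun x _ => f.continuous_derivAt.continuousAt) (Metric.dist_mem_uniformity hω)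
  obtain ⟨s, hs, hsub⟩ := Metric.mem_uniformity_dist.1 h
  refine ⟨s / 2, by positivity, fun x y hxy => ?_⟩
  obtain ⟨m, hm⟩ := exists_sub_intVec_mem_unitCube x
  have h1 := hsub (a := x - intVec m) (b := y - intVec m) (by
    rw [dist_sub_right]; linarith) hm
  simp only [Set.mem_ofPred_eq, f.derivAt_sub_intVec] at h1
  rw [← dist_eq_norm, dist_comm]
  exact h1.le

theorem TorusEndo.exists_forall_le_norm_derivAt {n : ℕ} (f : TorusEndo n)
    (hdet : ∀ x, (f.derivAt x).det ≠ 0) :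
    ∃ μ > 0, ∀ x v, μ * ‖v‖ ≤ ‖f.derivAt x v‖ := by
  let e : Cover n → (Cover n ≃L[ℝ] Cover n) := fun x =>
    (f.derivAt x).toContinuousLinearEquivOfDetNeZero (hdet x)
  have he : ∀ x, (e x : Cover n →L[ℝ] Cover n) = f.derivAt x := fun x => by ext; simp [e]
  have hc : Continuous fun x => ContinuousLinearMap.inverse (f.derivAt x) := by
    rw [continuous_iff_continuousAt]
    intro x
    refine ContinuousAt.comp (g := ContinuousLinearMap.inverse) ?_
      f.continuous_derivAt.continuousAt
    rw [← he x]
    exact (contDiffAt_map_inverse (n := 1) (e x)).continuousAt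
  obtain ⟨C, hC⟩ := (isCompact_unitCube n).exists_bound_of_continuousOn hc.continuousOn
  have hC' : ∀ x, ‖ContinuousLinearMap.inverse (f.derivAt x)‖ ≤ max C 1 := by
    intro x
    obtain ⟨m, hm⟩ := exists_sub_intVec_mem_unitCube x
    have := hC _ hm
    rw [f.derivAt_sub_intVec] at this
    exact this.trans (le_max_left _ _)
  have hpos : 0 < max C 1 := lt_max_of_lt_right one_pos
  refine ⟨(max C 1)⁻¹, inv_pos.2 hpos, fun x v => ?_⟩
  rw [inv_mul_le_iff₀ hpos]
  have h1 : ContinuousLinearMap.inverse (f.derivAt x) (f.derivAt x v) = v := by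
    rw [← he x, ContinuousLinearMap.inverse_equiv]
    simp
  calc ‖v‖ = ‖ContinuousLinearMap.inverse (f.derivAt x) (f.derivAt x v)‖ := by rw [h1]
    _ ≤ ‖ContinuousLinearMap.inverse (f.derivAt x)‖ * ‖f.derivAt x v‖ :=
        ContinuousLinearMap.le_opNorm _ _
    _ ≤ _ := by gcongr; exact hC' x

theorem TorusEndo.exists_forall_lt_abs_det {n : ℕ} (f : TorusEndo n) {σ : ℝ}
    (hσ : ∀ x, σ < |(f.derivAt x).det|) :
    ∃ ε > 0, ∀ x (L : Cover n →L[ℝ] Cover n), ‖f.derivAt x - L‖ < ε → σ < |L.det| := by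
  have hopen : IsOpen {L : Cover n →L[ℝ] Cover n | σ < |L.det|} :=
    isOpen_lt continuous_const ContinuousLinearMap.continuous_det.abs
  obtain ⟨ε, hε, hsub⟩ := ((isCompact_unitCube n).image f.continuous_derivAt).exists_thickening_subset_open
    hopen (by rintro _ ⟨x, -, rfl⟩; exact hσ x)
  refine ⟨ε, hε, fun x L hL => hsub (Metric.mem_thickening_iff.2 ?_)⟩
  obtain ⟨m, hm⟩ := exists_sub_intVec_mem_unitCube x
  refine ⟨_, ⟨_, hm, rfl⟩, ?_⟩
  rwa [f.derivAt_sub_intVec, dist_comm, dist_eq_norm]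

theorem le_norm_of_lt_minNorm {n : ℕ} {L : Cover n →L[ℝ] Cover n} {lam : ℝ} (h0 : 0 < lam)
    (h : lam < minNorm L) (v : Cover n) : lam * ‖v‖ ≤ ‖L v‖ := by
  unfold minNorm at h
  by_cases hL : L.IsInvertible
  · obtain ⟨e, rfl⟩ := hL
    rw [ContinuousLinearMap.inverse_equiv] at h
    have hpos : 0 < ‖(e.symm : Cover n →L[ℝ] Cover n)‖ := inv_pos.1 (h0.trans h)
    have h1 : ‖v‖ ≤ ‖(e.symm : Cover n →L[ℝ] Cover n)‖ * ‖e v‖ := by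
      have := (e.symm : Cover n →L[ℝ] Cover n).le_opNorm (e v)
      simpa using this
    calc lam * ‖v‖ ≤ ‖(e.symm : Cover n →L[ℝ] Cover n)‖⁻¹ *
          (‖(e.symm : Cover n →L[ℝ] Cover n)‖ * ‖e v‖) := by gcongr
      _ = ‖e v‖ := by field_simp
  -- The inverse of a noninvertible map is `0` by convention, so `minNorm` is `0` as well.
  · rw [ContinuousLinearMap.inverse_of_not_isInvertible hL, norm_zero, inv_zero] at h
    linarith

/-! ### Growth of open sets to a definite size, and the conclusion. -/

theorem maxDist_triangle {n : ℕ} (x y z : Cover n) : maxDist x z ≤ maxDist x y + maxDist y z :=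
  dist_triangle _ _ _

theorem maxDist_comm {n : ℕ} (x y : Cover n) : maxDist x y = maxDist y x := dist_comm _ _

/-- A path which stays away from the preimage of `U` and whose endpoints are far apart is mapped by
every map `h` near the identity to a path which meets the preimage of `Λ`. -/
theorem LargeArcsMeet.exists_mem_of_path {n : ℕ} {U Λ : Set (UnitAddTorus (Fin n))}
    (hΛ : IsClosed Λ) {δ η ρ : ℝ} (harcs : LargeArcsMeet Uᶜ Λ δ) (hδ0 : 0 ≤ δ) (hδ : δ < 1)
    (hρη : ρ < η) {h : Cover n → Cover n} (hh : Continuous h) (hid : ∀ x, dist (h x) x ≤ ρ)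
    {α : ℝ → Cover n} (hα : Continuous α) {s t : ℝ} (hst : s ≤ t)
    (hfar : δ + 2 * ρ < maxDist (α s) (α t))
    (haway : ∀ u ∈ Set.Icc s t, ∀ p, torusProj p ∈ U → η ≤ maxDist (α u) p) :
    ∃ u ∈ Set.Icc s t, torusProj (h (α u)) ∈ Λ := by
  by_contra hcon
  push Not at hcon
  have hΛ' : IsClosed (torusProj ⁻¹' Λ : Set (Cover n)) := hΛ.preimage continuous_torusProj
  have hmd : ∀ x, maxDist (h x) x ≤ ρ := fun x => (maxDist_le_dist _ _).trans (hid x)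
  obtain ⟨x, hx, hxΛ⟩ := harcs.exists_mem_of_isPreconnected hδ0 hδ
    (K := (fun u => h (α u)) '' Set.Icc s t)
    -- If the image path missed `Λ`, this would be an open neighbourhood of it avoiding both `U` and
    -- `Λ`, against the arc property.
    (O := (closure (torusProj ⁻¹' U))ᶜ ∩ (torusProj ⁻¹' Λ)ᶜ)
    (isPreconnected_Icc.image _ (hh.comp hα).continuousOn)
    (isClosed_closure.isOpen_compl.inter hΛ'.isOpen_compl)
    (fun x hx hxU => hx.1 (subset_closure hxU))
    (by
      rintro _ ⟨u, hu, rfl⟩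
      refine ⟨fun hcl => ?_, hcon u hu⟩
      obtain ⟨p, hp, hdp⟩ := Metric.mem_closure_iff.1 hcl (η - ρ) (by linarith)
      have h1 := haway u hu p hp
      have h2 := hmd (α u)
      rw [maxDist_comm] at h2
      have h3 := maxDist_triangle (α u) (h (α u)) p
      have h4 := maxDist_le_dist (h (α u)) p
      linarith)
    ⟨s, ⟨le_rfl, hst⟩, rfl⟩ ⟨t, ⟨hst, le_rfl⟩, rfl⟩
    (by
      have h1 := hmd (α s)
      have h2 := hmd (α t)
      have h3 := maxDist_triangle (α s) (h (α s)) (α t)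
      have h4 := maxDist_triangle (h (α s)) (h (α t)) (α t)
      rw [maxDist_comm] at h1
      linarith)
  exact hx.2 hxΛ

/-- Some iterate of every open set under a map near `F` contains a ball of a definite size. -/
theorem exists_closedBall_subset_iterate_image {n : ℕ} {U Λ : Set (UnitAddTorus (Fin n))}
    {c : Cover n} (hΛ : IsClosed Λ) {δ η ρ lam σ : ℝ} (harcs : LargeArcsMeet Uᶜ Λ δ)
    (hδ0 : 0 ≤ δ) (hρ : 0 < ρ) (hρη : ρ < η)
    (hgap : δ + 2 * ρ + 2 * η < internalDiam c U)
    {F G Finv : Cover n → Cover n} (hFl : ∀ x, Finv (F x) = x)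
    (hFr : ∀ y, F (Finv y) = y) (hFinv : Continuous Finv)
    (hinv : ∀ x, torusProj x ∈ Λ → torusProj (F x) ∈ Λ) (hlam : 1 < lam)
    (hFexp : ∀ x ∈ Metric.cthickening (2 * ρ) (torusProj ⁻¹' Λ), ExpandsAt F lam ρ x)
    (hGexp : ∀ x ∈ Metric.cthickening ρ (torusProj ⁻¹' Λ), ExpandsAt G lam ρ x)
    (hclose : ∀ x, dist (F x) (G x) ≤ (lam - 1) * ρ)
    (hG : Differentiable ℝ G) (hinj : Function.Injective G) (hopen : IsOpenMap G)
    (hσ : 1 < σ) (hdet : ∀ x, σ ≤ |(fderiv ℝ G x).det|) {A : Set (Cover n)} (hA : IsOpen A)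
    (hne : A.Nonempty) : ∃ m z, Metric.closedBall z ρ ⊆ G^[m] '' A := by
  have hδ1 : δ < 1 := by linarith [internalDiam_le_one c U]
  obtain ⟨x₀, hx₀⟩ := hne
  obtain ⟨r₀, hr₀, hball⟩ := Metric.isOpen_iff.1 hA x₀ hx₀
  obtain ⟨C, hC, hCd⟩ := exists_dist_le_mul_maxDist n
  obtain ⟨m, hm⟩ := exists_iterate_image_not_subset_closedBall hG hinj hopen hσ hdet
    (Metric.isOpen_ball (x := x₀) (ε := r₀)) ⟨x₀, Metric.mem_ball_self hr₀⟩ (C * 4)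
  obtain ⟨_, ⟨y₀, hy₀, rfl⟩, hfar⟩ := Set.not_subset.1 (hm (G^[m] x₀))
  set W := G^[m] '' Metric.ball x₀ r₀ with hW
  have hWo : IsOpen W := hopen.iterate_nat m _ Metric.isOpen_ball
  set α : ℝ → Cover n := fun t => G^[m] (AffineMap.lineMap y₀ x₀ t) with hαdef
  have hα : Continuous α := (hG.continuous.iterate m).comp AffineMap.lineMap_continuous
  have hαW : ∀ u ∈ Set.Icc (0 : ℝ) 1, α u ∈ W := by
    intro u hu
    refine ⟨_, (convex_ball x₀ r₀).segment_subset hy₀ (Metric.mem_ball_self hr₀) ?_, rfl⟩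
    rw [segment_eq_image_lineMap]
    exact ⟨u, hu, rfl⟩
  have hlong : 4 < maxDist (α 0) (α 1) := by
    have h1 : C * 4 < dist (G^[m] y₀) (G^[m] x₀) := not_le.1 hfar
    have h2 := h1.trans_le (hCd _ _)
    simpa [hαdef] using lt_of_mul_lt_mul_left h2 hC.le
  obtain ⟨s, t, hs, hst, ht, hd, haway⟩ := exists_subpath_away_preimage (c := c) (U := U)
    (δ := δ + 2 * ρ) (by positivity) (hρ.trans hρη) hgap hα hlong
  have hsub : α '' Set.Icc s t ⊆ W := by
    rintro _ ⟨u, hu, rfl⟩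
    exact hαW u ⟨hs.trans hu.1, hu.2.trans ht⟩
  obtain ⟨s', hs', hs'W⟩ := (isCompact_Icc.image hα).exists_cthickening_subset_open hWo hsub
  -- The time `N` is fixed after the path and before the shadowing map, so shadowing for a finite
  -- time is enough.
  obtain ⟨N, hN⟩ := pow_unbounded_of_one_lt (ρ / s') hlam
  rw [div_lt_iff₀ hs'] at hN
  obtain ⟨h, hh, hid, hshadow⟩ := exists_shadowing_map hFl hFr hFinv hG.continuous hinv hρ hFexp
    hclose N
  obtain ⟨u, hu, huΛ⟩ := harcs.exists_mem_of_path hΛ hδ0 hδ1 hρη hh hid hα hst hd haway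
  have hx := hshadow (α u) huΛ
  have hWball : Metric.closedBall (α u) s' ⊆ W :=
    (Metric.closedBall_subset_cthickening (Set.mem_image_of_mem α hu) s').trans hs'W
  have hbig := closedBall_subset_iterate_image hlam.le hρ.le hs'.le hWball N
    fun k hk => hGexp _ (hx k hk.le)
  rw [min_eq_right hN.le] at hbig
  refine ⟨N + m, _, hbig.trans ?_⟩
  rw [Function.iterate_add, Set.image_comp]
  exact Set.image_mono (Set.image_mono hball)

theorem mainTheorem2 {n : ℕ} (f : TorusEndo n) (hvol : f.VolumeExpanding)
    (hdense : f.DensePreOrbits)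
    (U₀ : Set (UnitAddTorus (Fin n))) (hU₀ : IsOpen U₀)
    (c : Cover n) (hdiam : maxDiam (frameLift c U₀) < 1)
    (Λ : Set (UnitAddTorus (Fin n))) (hΛ : f.IsLocallyMaximalExpandingSet Λ)
    (hΛU₀ : Λ ⊆ U₀ᶜ)
    (δ₀ : ℝ) (hδ₀ : 0 < δ₀) (hδ₀' : δ₀ < internalDiam c U₀)
    (harcs : LargeArcsMeet U₀ᶜ Λ δ₀) :
    C1Robustly TorusEndo.DensePreOrbits f := by
  obtain ⟨σ, hσ, hdet⟩ := hvol
  obtain ⟨lam, hlam, hΛexp⟩ := hΛ.expanding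
  obtain ⟨μ, hμ, hμF⟩ := f.exists_forall_le_norm_derivAt fun x hx => by
    have := hdet x
    rw [hx, abs_zero] at this
    linarith
  -- One `ω` pays for the variation of the derivative of `f` on balls of radius `s`, the other for
  -- passing from `f` to `g`.
  obtain ⟨ω, hω, hωlam, hωμ⟩ : ∃ ω > 0, 2 * ω < lam - 1 ∧ 2 * ω < μ :=
    ⟨min (lam - 1) μ / 3, by have := sub_pos.2 hlam; positivity,
      by linarith [min_le_left (lam - 1) μ, sub_pos.2 hlam], by linarith [min_le_right (lam - 1) μ]⟩
  obtain ⟨s, hs, hsF⟩ := f.uniformContinuous_derivAt hω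
  set gap := internalDiam c U₀ - δ₀ with hgap
  have hgap0 : 0 < gap := sub_pos.2 hδ₀'
  -- A point of the `2 * ρ`-thickening is within `3 * ρ` of a point over `Λ`, and its `ρ`-ball
  -- within `4 * ρ`. With `η = 2 * ρ` the gap condition needs `6 * ρ < gap`.
  obtain ⟨ρ, hρ, hρs, hρgap⟩ : ∃ ρ > 0, 4 * ρ ≤ s ∧ 8 * ρ ≤ gap :=
    ⟨min (s / 4) (gap / 8), by positivity, by linarith [min_le_left (s / 4) (gap / 8)],
      by linarith [min_le_right (s / 4) (gap / 8)]⟩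
  -- uniform expansion for all maps near the lift of `f`
  have hexp : ∀ G : Cover n → Cover n, Differentiable ℝ G →
      (∀ x, ‖f.derivAt x - fderiv ℝ G x‖ ≤ ω) →
      (∀ x, ExpandsAt G (μ - 2 * ω) s x) ∧
      ∀ x ∈ Metric.cthickening (2 * ρ) (torusProj ⁻¹' Λ), ExpandsAt G (lam - 2 * ω) ρ x := by
    intro G hG hGω
    have hderiv : ∀ x y, dist x y ≤ s → ‖fderiv ℝ G y - f.derivAt x‖ ≤ 2 * ω := by
      intro x y hxy
      have h1 := norm_sub_le_norm_sub_add_norm_sub (fderiv ℝ G y) (f.derivAt y) (f.derivAt x)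
      have h2 := hGω y
      rw [norm_sub_rev] at h2
      linarith [hsF x y hxy]
    refine ⟨fun x => expandsAt_of_fderiv hG (f.derivAt x) (by positivity) hωμ (hμF x)
      fun y hy => hderiv x y (by rw [dist_comm]; exact hy), fun x hx => ?_⟩
    obtain ⟨p, hp, hxp⟩ := Metric.mem_thickening_iff.1
      (Metric.cthickening_subset_thickening' (δ₂ := 3 * ρ) (by positivity) (by linarith) _ hx)
    refine expandsAt_of_fderiv hG (f.derivAt p) (by positivity) (by linarith)
      (le_norm_of_lt_minNorm (by linarith) (hΛexp p hp)) fun y hy => hderiv p y ?_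
    rw [Metric.mem_closedBall] at hy
    rw [dist_comm]
    linarith [dist_triangle y x p]
  have hκ : 0 < μ - 2 * ω := by linarith
  have hlam' : 1 < lam - 2 * ω := by linarith
  have hFd : Differentiable ℝ f.lift := f.contDiff_lift.differentiable one_ne_zero
  obtain ⟨hFexp, hFΛ⟩ := hexp f.lift hFd fun x => by
    rw [TorusEndo.derivAt, sub_self, norm_zero]; exact hω.le
  let e := (Equiv.ofBijective f.lift ⟨injective_of_expandsAt hκ hs hFd.continuous hFexp,
    surjective_of_expandsAt hκ hs hFexp⟩).toHomeomorphOfContinuousOpen hFd.continuous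
      (isOpenMap_of_expandsAt hκ hs hFexp)
  obtain ⟨ε₁, hε₁, hcovers⟩ := exists_forall_iterate_image_covers hdense hFd.continuous
    f.isTorusLift_lift hρ hκ hs
  obtain ⟨ε₂, hε₂, hdetε⟩ := f.exists_forall_lt_abs_det hdet
  obtain ⟨C, hC, hCd⟩ := exists_dist_le_mul_maxDist n
  have hτ : 0 < min ε₁ ((lam - 2 * ω - 1) * ρ) :=
    lt_min hε₁ (mul_pos (by linarith) hρ)
  -- The bounds serve, in order, the choice of a nearby lift, the expansion estimates, the
  -- determinant, and the covering and shadowing conditions; `C` compares the Euclidean and maximum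
  -- distances.
  obtain ⟨ε, hε, hε4, hεω, hεε₂, hετ⟩ : ∃ ε > 0, ε ≤ 1 / 4 ∧ ε ≤ ω ∧ ε ≤ ε₂ ∧
      C * ε ≤ min ε₁ ((lam - 2 * ω - 1) * ρ) := by
    refine ⟨min (min (1 / 4) ω) (min ε₂ (min ε₁ ((lam - 2 * ω - 1) * ρ) / C)), by positivity,
      (min_le_left _ _).trans (min_le_left _ _), (min_le_left _ _).trans (min_le_right _ _),
      (min_le_right _ _).trans (min_le_left _ _), ?_⟩
    rw [mul_comm, ← le_div_iff₀ hC]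
    exact (min_le_right _ _).trans (min_le_right _ _)
  refine ⟨ε, hε, fun g hg => ?_⟩
  obtain ⟨G, hGd, hGlift, hGclose, hGderiv⟩ := hg.exists_lift hε4
  obtain ⟨hGexp, hGΛ⟩ := hexp G hGd fun x => (hGderiv x).le.trans hεω
  have hGF : ∀ x, dist (f.lift x) (G x) < min ε₁ ((lam - 2 * ω - 1) * ρ) := fun x =>
    ((hCd _ _).trans_lt (mul_lt_mul_of_pos_left (hGclose x) hC)).trans_le hετ
  intro p
  rw [dense_iff_inter_open]
  intro V hV hVne
  obtain ⟨v, hv⟩ := hVne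
  obtain ⟨v', rfl⟩ : ∃ v', torusProj v' = v := by
    choose v' hv' using fun i => QuotientAddGroup.mk_surjective (v i)
    exact ⟨WithLp.toLp 2 v', funext hv'⟩
  obtain ⟨q, rfl⟩ : ∃ q, torusProj q = p := by
    choose q hq using fun i => QuotientAddGroup.mk_surjective (p i)
    exact ⟨WithLp.toLp 2 q, funext hq⟩
  obtain ⟨m, z, hz⟩ := exists_closedBall_subset_iterate_image (c := c) (η := 2 * ρ)
    hΛ.isCompact.isClosed harcs hδ₀.le
    hρ (by linarith) (by linarith) (F := f.lift) (Finv := e.symm)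
    (fun x => e.symm_apply_apply x) (fun y => e.apply_symm_apply y) e.symm.continuous
    (fun x hx => by
      rw [f.isTorusLift_lift, ← hΛ.invariant]
      exact Set.mem_image_of_mem _ hx) hlam' hFΛ
    (fun x hx => hGΛ x (Metric.cthickening_mono (by linarith) _ hx))
    (fun x => ((hGF x).trans_le (min_le_right _ _)).le) hGd
    (injective_of_expandsAt hκ hs hGd.continuous hGexp) (isOpenMap_of_expandsAt hκ hs hGexp) hσ
    (fun x => (hdetε x _ ((hGderiv x).trans_le hεε₂)).le)
    (hV.preimage continuous_torusProj) ⟨v', hv⟩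
  obtain ⟨k, w, hw, hwq⟩ := hcovers G (fun x => (hGF x).trans_le (min_le_left _ _)) hGexp g.toFun
    hGlift z q
  obtain ⟨y, hy, rfl⟩ := hz hw
  refine ⟨torusProj y, hy, k + m, ?_⟩
  rw [Function.iterate_add_apply, ← hGlift.iterate m, hwq]
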